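/- Write $\lg=\log_2$. A permutation $\pi$ of $[n]$ is \emph{covered by $\sigma$ shuffled upsequences} if its positions can be partitioned into $\sigma$ nonempty (not necessarily contiguous) classes such that the values of $\pi$ increase along each class; for instance, $\sigma$ may be the minimum number of classes in such a partition. The computation model is the unit-cost word RAM (arithmetic, bitwise, shift and comparison operations on words, direct addressing of memory by words) with word length $w=\Theta(\log n)$; more precisely, there is an absolute constant $w_0$ such that the following holds for all $c$ and all word lengths $\lfloor\lg n\rfloor+w_0\le w\le c(\lfloor\lg n\rfloor+1)$, where the two query programs, the $o(1)$ and the constants in the $O(\cdot)$ depend only on $c$. There is an encoding scheme that encodes every permutation $\pi$ over $[n]$, $n\ge 1$, covered by $\sigma$ shuffled upsequences, as a bit string of length at most $$2n\lg\sigma\,(1+o(1))+\sigma\lg\frac{n}{\sigma}+O(\sigma),$$ where the $o(1)$ term tends to $0$ as $n\to\infty$, uniformly in $\sigma$ and $\pi$. With this bit string, packed into words, as the initial content of the memory, two fixed programs, independent of $n$, $w$, $\sigma$ and $\pi$, compute $\pi(i)$ and $\pi^{-1}(i)$, respectively, in time $O(1+\log\sigma)$ for every $i\in[n]$. -/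

import Mathlib

open Filter Topology

/-- A permutation `π` of `{0, …, n-1}` is covered by `σ` shuffled upsequences: the positions can be
partitioned into exactly `σ` nonempty (not necessarily contiguous) classes, along each of which
the values of `π` increase. -/
def IsCoveredBySUS {n : ℕ} (π : Equiv.Perm (Fin n)) (σ : ℕ) : Prop :=
  ∃ D : Finpartition (Finset.univ : Finset (Fin n)),
    D.parts.card = σ ∧ ∀ s ∈ D.parts, StrictMonoOn π (s : Set (Fin n))

namespace WordRAM

/-! A unit-cost word RAM with words of `w` bits, programmed in structured form. A program is a
finite object that does not mention `w`. -/

/-- The arithmetic, bitwise and comparison operations on words. -/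
inductive Op where
  | add | sub | mul | div | mod | and | or | xor | shl | shr | lt | eq

/-- Arithmetic is unsigned, modulo `2 ^ w`; comparisons return `1` or `0`. -/
def Op.eval {w : ℕ} : Op → BitVec w → BitVec w → BitVec w
  | .add, x, y => x + y
  | .sub, x, y => x - y
  | .mul, x, y => x * y
  | .div, x, y => x / y
  | .mod, x, y => x % y
  | .and, x, y => x &&& y
  | .or, x, y => x ||| y
  | .xor, x, y => x ^^^ y
  | .shl, x, y => x <<< y.toNat
  | .shr, x, y => x >>> y.toNat
  | .lt, x, y => if x.toNat < y.toNat then BitVec.ofNat w 1 else BitVec.ofNat w 0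
  | .eq, x, y => if x = y then BitVec.ofNat w 1 else BitVec.ofNat w 0

/-- A machine configuration: registers, and a memory whose cells are addressed by words. -/
structure State (w : ℕ) where
  reg : ℕ → BitVec w
  mem : BitVec w → BitVec w

/-- Expressions: constants, registers, operations, and the content of a memory cell. -/
inductive Expr where
  | const (k : ℕ)
  | reg (r : ℕ)
  | op (o : Op) (a b : Expr)
  | load (a : Expr)

def Expr.eval {w : ℕ} (s : State w) : Expr → BitVec w
  | .const k => BitVec.ofNat w k
  | .reg r => s.reg r
  | .op o a b => o.eval (a.eval s) (b.eval s)
  | .load a => s.mem (a.eval s)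

/-- Every constant, register access, operation and memory access costs one step. -/
def Expr.cost : Expr → ℕ
  | .const _ => 1
  | .reg _ => 1
  | .op _ a b => a.cost + b.cost + 1
  | .load a => a.cost + 1

/-- Programs. -/
inductive Prog where
  | skip
  | assign (r : ℕ) (e : Expr)
  | store (a e : Expr)
  | seq (p q : Prog)
  | branch (e : Expr) (p q : Prog)
  | loop (e : Expr) (p : Prog)

/-- `Exec p s s' t`: started in configuration `s`, the program `p` halts in configuration `s'`
after exactly `t` steps. Branches and loops test whether a word is nonzero. -/
inductive Exec {w : ℕ} : Prog → State w → State w → ℕ → Prop where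
  | skip (s : State w) : Exec .skip s s 1
  | assign (r : ℕ) (e : Expr) (s : State w) :
      Exec (.assign r e) s { s with reg := Function.update s.reg r (e.eval s) } (e.cost + 1)
  | store (a e : Expr) (s : State w) :
      Exec (.store a e) s { s with mem := Function.update s.mem (a.eval s) (e.eval s) }
        (a.cost + e.cost + 1)
  | seq {p q : Prog} {s s' s'' : State w} {t t' : ℕ} :
      Exec p s s' t → Exec q s' s'' t' → Exec (.seq p q) s s'' (t + t')
  | branch_true {e : Expr} {p q : Prog} {s s' : State w} {t : ℕ} :
      e.eval s ≠ 0 → Exec p s s' t → Exec (.branch e p q) s s' (e.cost + 1 + t)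
  | branch_false {e : Expr} {p q : Prog} {s s' : State w} {t : ℕ} :
      e.eval s = 0 → Exec q s s' t → Exec (.branch e p q) s s' (e.cost + 1 + t)
  | loop_true {e : Expr} {p : Prog} {s s' s'' : State w} {t t' : ℕ} :
      e.eval s ≠ 0 → Exec p s s' t → Exec (.loop e p) s' s'' t' →
        Exec (.loop e p) s s'' (e.cost + 1 + t + t')
  | loop_false {e : Expr} {p : Prog} {s : State w} :
      e.eval s = 0 → Exec (.loop e p) s s (e.cost + 1)

/-- The memory that holds the bit string `E`, packed `w` bits to a cell from address `0` on (least
significant bit first), and zeros after the end of `E`. -/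
def packed (w : ℕ) (E : List Bool) : BitVec w → BitVec w :=
  fun a => BitVec.ofFnLE fun j : Fin w => E.getD (a.toNat * w + j) false

/-- The initial configuration of a query: the memory holds `E`, register `0` holds the argument
`x`, all other registers hold zero. -/
def init (w : ℕ) (E : List Bool) (x : ℕ) : State w where
  reg := Function.update (fun _ => 0) 0 (BitVec.ofNat w x)
  mem := packed w E

/-- On the word RAM with `w`-bit words and data `E`, the program `p` with argument `x` halts after
exactly `t` steps with the answer `y` in register `0`. -/
def Answers (p : Prog) (w : ℕ) (E : List Bool) (x y t : ℕ) : Prop :=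
  ∃ s' : State w, Exec p (init w E x) s' t ∧ (s'.reg 0).toNat = y

end WordRAM

/-! Label every position by its class. Stable sorting of the positions by label, and stable sorting
of the values by the label of their preimage, both list the classes one after another, each in
increasing order. Since `π` increases along each class, position `i` and value `π i` come to the
same place, so `π` is a stable sorting followed by the inverse of another
(`IsCoveredBySUS.exists_pos_eq`). It remains to store two strings of `n` labels, which accounts for
the `2 n lg σ` bits, and to evaluate and invert stable sortings.

Radix sort splits a sorting by `k`-digit labels into `k` sortings by single digits
(`exists_sortChain`). For a given accuracy the base can be kept bounded: a small `σ` is its own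
base, and for a large `σ` binary digits waste little, since rounding up `lg σ` is then relatively
cheap (`exists_radix`). There are `O(1 + lg σ)` levels, each handled in constant time.

On one level the place of a position is an offset plus a rank, and inversion is a selection. The
string is cut into blocks of chunks of `s ^ 4` symbols, where `s` is about `lg lg n`. Chunks are
stored as numbers in base `d` and decoded by tables shared by all levels; two layers of directories
supply the ranks at block and chunk boundaries (`pos_eq`, `pos_sel`). Selection needs a predecessor
search, done with a constant number of probes (`pred_lookup`). `Represents.ev_pos` and
`Represents.ev_posInv` express both directions as word RAM expressions. The redundancy is `O(d / s)`
bits per symbol (`stride_mul_le`, `Regime.total_mul_le`), which vanishes for bounded `d`.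

Thus every relative error `δ` is achieved for large `n`. Explicit tables serve the remaining `n`,
and `exists_tendsto_zero` merges the errors into one null sequence. -/

namespace WordRAM

/-! ### Word arithmetic and its agreement with natural numbers -/

variable {w : ℕ}

/-- The expression `e` evaluates to the residue of `x` modulo `2 ^ w`. -/
def Expr.Ev (s : State w) (e : Expr) (x : ℕ) : Prop := e.eval s = BitVec.ofNat w x

namespace Expr

instance : Add Expr := ⟨op .add⟩
instance : Sub Expr := ⟨op .sub⟩
instance : Mul Expr := ⟨op .mul⟩
instance : Div Expr := ⟨op .div⟩
instance : Mod Expr := ⟨op .mod⟩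

variable {s : State w} {a b : Expr} {x y : ℕ}

theorem Ev.congr {e : Expr} (h : e.Ev s x) (hxy : x = y) : e.Ev s y := hxy ▸ h

theorem ev_const (k : ℕ) : (const k).Ev s k := rfl

/-- Reduction modulo `2 ^ w` is a ring homomorphism, so sums, products and nonnegative differences
need no overflow bounds. Division, remainder, shift and comparison read the representative and do
need them. -/
theorem Ev.add (ha : a.Ev s x) (hb : b.Ev s y) : (a + b).Ev s (x + y) := by
  change (op .add a b).Ev s _
  simp only [Ev, eval, Op.eval] at *
  rw [ha, hb, BitVec.ofNat_add]

theorem Ev.mul (ha : a.Ev s x) (hb : b.Ev s y) : (a * b).Ev s (x * y) := by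
  change (op .mul a b).Ev s _
  simp only [Ev, eval, Op.eval] at *
  rw [ha, hb, BitVec.ofNat_mul]

theorem Ev.sub (ha : a.Ev s x) (hb : b.Ev s y) (h : y ≤ x) : (a - b).Ev s (x - y) := by
  change (op .sub a b).Ev s _
  simp only [Ev, eval, Op.eval] at *
  obtain ⟨z, rfl⟩ := Nat.exists_eq_add_of_le h
  rw [ha, hb, Nat.add_sub_cancel_left, BitVec.ofNat_add, add_comm, add_sub_cancel_right]

theorem Ev.div (ha : a.Ev s x) (hb : b.Ev s y) (hx : x < 2 ^ w) (hy : y < 2 ^ w) :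
    (a / b).Ev s (x / y) := by
  change (op .div a b).Ev s _
  simp only [Ev, eval, Op.eval] at *
  rw [ha, hb]
  apply BitVec.eq_of_toNat_eq
  rw [BitVec.toNat_udiv, BitVec.toNat_ofNat, BitVec.toNat_ofNat, BitVec.toNat_ofNat,
    Nat.mod_eq_of_lt hx, Nat.mod_eq_of_lt hy,
    Nat.mod_eq_of_lt ((Nat.div_le_self _ _).trans_lt hx)]

theorem Ev.mod (ha : a.Ev s x) (hb : b.Ev s y) (hx : x < 2 ^ w) (hy : y < 2 ^ w) :
    (a % b).Ev s (x % y) := by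
  change (op .mod a b).Ev s _
  simp only [Ev, eval, Op.eval] at *
  rw [ha, hb]
  apply BitVec.eq_of_toNat_eq
  rw [BitVec.toNat_umod, BitVec.toNat_ofNat, BitVec.toNat_ofNat, BitVec.toNat_ofNat,
    Nat.mod_eq_of_lt hx, Nat.mod_eq_of_lt hy,
    Nat.mod_eq_of_lt ((Nat.mod_le _ _).trans_lt hx)]

theorem Ev.shr (ha : a.Ev s x) (hb : b.Ev s y) (hx : x < 2 ^ w) (hy : y < 2 ^ w) :
    (op .shr a b).Ev s (x / 2 ^ y) := by
  simp only [Ev, eval, Op.eval] at *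
  rw [ha, hb]
  apply BitVec.eq_of_toNat_eq
  rw [BitVec.toNat_ushiftRight, BitVec.toNat_ofNat, BitVec.toNat_ofNat, BitVec.toNat_ofNat,
    Nat.mod_eq_of_lt hx, Nat.mod_eq_of_lt hy, Nat.shiftRight_eq_div_pow,
    Nat.mod_eq_of_lt ((Nat.div_le_self _ _).trans_lt hx)]

theorem Ev.lt (ha : a.Ev s x) (hb : b.Ev s y) (hx : x < 2 ^ w) (hy : y < 2 ^ w) :
    (op .lt a b).Ev s (if x < y then 1 else 0) := by
  simp only [Ev, eval, Op.eval] at *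
  rw [ha, hb, BitVec.toNat_ofNat, BitVec.toNat_ofNat, Nat.mod_eq_of_lt hx, Nat.mod_eq_of_lt hy]
  split_ifs <;> rfl

/-- Truncated subtraction. -/
def monus (a b : Expr) : Expr := op .lt b a * (a - b)

theorem Ev.monus (ha : a.Ev s x) (hb : b.Ev s y) (hx : x < 2 ^ w) (hy : y < 2 ^ w) :
    (monus a b).Ev s (x - y) := by
  by_cases h : y < x
  · exact ((hb.lt ha hy hx).mul (ha.sub hb h.le)).congr (by simp [h])
  · have h1 := hb.lt ha hy hx
    change (op .mul (op .lt b a) (op .sub a b)).Ev s _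
    simp only [Ev, eval, Op.eval, if_neg h] at *
    rw [h1, Nat.sub_eq_zero_of_le (not_lt.mp h)]
    exact BitVec.zero_mul

end Expr

/-- The memory of `s` agrees with the cell contents `img` at the addresses below `L`. -/
def State.Holds (s : State w) (img : ℕ → ℕ) (L : ℕ) : Prop :=
  ∀ x < L, s.mem (BitVec.ofNat w x) = BitVec.ofNat w (img x)

theorem Expr.Ev.load {s : State w} {img : ℕ → ℕ} {L x : ℕ} {a : Expr} (hs : s.Holds img L)
    (ha : a.Ev s x) (hx : x < L) : (Expr.load a).Ev s (img x) := by
  have := hs x hx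
  simp only [Expr.Ev, Expr.eval] at *
  rw [ha, this]

/-! ### Packed fields, loops and bit strings -/

/-- The number with the base-`D` digits `S 0, …, S (g - 1)`, least significant first. -/
def code (D : ℕ) : ℕ → (ℕ → ℕ) → ℕ
  | 0, _ => 0
  | g + 1, S => S 0 % D + D * code D g fun i => S (i + 1)

theorem code_lt {D : ℕ} (hD : 0 < D) (g : ℕ) (S : ℕ → ℕ) : code D g S < D ^ g := by
  induction g generalizing S with
  | zero => simp [code]
  | succ g ih =>
    have h1 := ih fun i => S (i + 1)
    have h2 := Nat.mod_lt (S 0) hD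
    calc S 0 % D + D * code D g (fun i => S (i + 1))
        < D + D * code D g (fun i => S (i + 1)) := by omega
      _ = D * (code D g (fun i => S (i + 1)) + 1) := by ring
      _ ≤ D * D ^ g := Nat.mul_le_mul_left _ h1
      _ = D ^ (g + 1) := by ring

theorem code_digit {D : ℕ} (hD : 0 < D) {g i : ℕ} (hi : i < g) (S : ℕ → ℕ) :
    code D g S / D ^ i % D = S i % D := by
  induction g generalizing S i with
  | zero => omega
  | succ g ih =>
    cases i with
    | zero => simp [code]
    | succ i =>
      rw [pow_succ', ← Nat.div_div_eq_div_mul, code, Nat.add_mul_div_left _ _ hD,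
        Nat.div_eq_of_lt (Nat.mod_lt _ hD), zero_add, ih (by omega)]

/-- Field number `idx` of an array of fields of `fw` bits, `per` to a cell, based at `base`. -/
def fieldExpr (base idx fw fm per : Expr) : Expr :=
  .op .shr (.load (base + idx / per)) (idx % per * fw) % fm

/-- Fields never straddle cells, so one load, a shift by a multiple of `b` and a remainder extract a
field. The strict bound `b < w` makes the modulus `2 ^ b` itself a word. -/
theorem ev_field {s : State w} {img : ℕ → ℕ} {L B i b : ℕ} {base idx fw fm per : Expr}
    {fld : ℕ → ℕ} (hs : s.Holds img L) (hbase : base.Ev s B) (hidx : idx.Ev s i)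
    (hfw : fw.Ev s b) (hfm : fm.Ev s (2 ^ b)) (hper : per.Ev s (w / b))
    (hb : 0 < b) (hbw : b < w) (hi : i < 2 ^ w) (hL : B + i / (w / b) < L)
    (himg : img (B + i / (w / b)) = code (2 ^ b) (w / b) fun y => fld (i / (w / b) * (w / b) + y))
    (hfld : fld i < 2 ^ b) :
    (fieldExpr base idx fw fm per).Ev s (fld i) := by
  have hww : w < 2 ^ w := Nat.lt_two_pow_self
  have hp : 0 < w / b := Nat.div_pos hbw.le hb
  have hpw : w / b < 2 ^ w := (Nat.div_le_self _ _).trans_lt hww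
  have hm := Nat.mod_lt i hp
  have hsh : i % (w / b) * b < 2 ^ w := by
    refine lt_of_le_of_lt ?_ hww
    calc i % (w / b) * b ≤ w / b * b := Nat.mul_le_mul_right _ hm.le
      _ ≤ w := Nat.div_mul_le_self _ _
  have h1 := (hbase.add (hidx.div hper hi hpw)).load hs hL
  have hlt : img (B + i / (w / b)) < 2 ^ w := by
    rw [himg]
    refine (code_lt (by positivity) _ _).trans_le ?_
    rw [← pow_mul]
    exact Nat.pow_le_pow_right (by norm_num) (by rw [mul_comm]; exact Nat.div_mul_le_self _ _)
  have h2 := (h1.shr ((hidx.mod hper hi hpw).mul hfw) hlt hsh).mod hfm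
    ((Nat.div_le_self _ _).trans_lt hlt) (Nat.pow_lt_pow_right (by norm_num) hbw)
  refine h2.congr ?_
  rw [himg, mul_comm (i % (w / b)) b, pow_mul, code_digit (by positivity) hm, Nat.div_add_mod',
    Nat.mod_eq_of_lt hfld]

/-- Execution of a loop whose guard stays true along a chain of `k` states. -/
theorem Exec.iterate {e : Expr} {p : Prog} {t : ℕ} {k : ℕ} (st : ℕ → State w)
    (hg : ∀ i < k, e.eval (st i) ≠ 0) (hp : ∀ i < k, Exec p (st i) (st (i + 1)) t)
    (hk : e.eval (st k) = 0) :
    Exec (.loop e p) (st 0) (st k) (k * (e.cost + 1 + t) + (e.cost + 1)) := by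
  induction k generalizing st with
  | zero => simpa using Exec.loop_false hk
  | succ k ih =>
    have h := Exec.loop_true (hg 0 (by omega)) (hp 0 (by omega))
      (ih (fun i => st (i + 1)) (fun i hi => hg (i + 1) (by omega))
        (fun i hi => hp (i + 1) (by omega)) hk)
    convert h using 1
    ring

/-- The bit string that holds the first `L` cells of `img`. -/
def bits (w L : ℕ) (img : ℕ → ℕ) : List Bool :=
  List.ofFn fun j : Fin (L * w) => (img (j / w)).testBit (j % w)

theorem length_bits (w L : ℕ) (img : ℕ → ℕ) : (bits w L img).length = L * w := by
  simp [bits]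

theorem packed_bits {w L : ℕ} {img : ℕ → ℕ} (hL : L ≤ 2 ^ w) {x : ℕ} (hx : x < L) :
    packed w (bits w L img) (BitVec.ofNat w x) = BitVec.ofNat w (img x) := by
  apply BitVec.eq_of_getLsbD_eq
  intro i hi
  have hx' : (BitVec.ofNat w x).toNat = x := by
    rw [BitVec.toNat_ofNat, Nat.mod_eq_of_lt (hx.trans_le hL)]
  have hlt : x * w + i < L * w := by
    calc x * w + i < x * w + w := by omega
      _ = (x + 1) * w := by ring
      _ ≤ L * w := Nat.mul_le_mul_right _ hx
  have h1 : (x * w + i) / w = x := by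
    rw [mul_comm, Nat.mul_add_div (by omega), Nat.div_eq_of_lt hi, add_zero]
  have h2 : (x * w + i) % w = i := by
    rw [mul_comm, Nat.mul_add_mod, Nat.mod_eq_of_lt hi]
  rw [packed, BitVec.getLsbD_ofFnLE, BitVec.getLsbD_ofNat, dif_pos hi, hx']
  simp only [hi, decide_true, Bool.true_and]
  rw [List.getD_eq_getElem _ _ (by rw [length_bits]; exact hlt)]
  simp [bits, h1, h2]

end WordRAM

namespace StableSort

/-! Stable sorting of the positions below `N` of a string `S`, and its representation by blocks. -/

/-- The number of occurrences of `c` among the first `a` symbols. -/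
def cnt (S : ℕ → ℕ) (c a : ℕ) : ℕ := Nat.count (fun y => S y = c) a

/-- The number of symbols less than `c` among the first `N`. -/
def off (S : ℕ → ℕ) (N c : ℕ) : ℕ := Nat.count (fun y => S y < c) N

/-- The place of position `x` in the stable sorting. -/
def pos (S : ℕ → ℕ) (N x : ℕ) : ℕ := off S N (S x) + cnt S (S x) x

variable {S : ℕ → ℕ}

theorem cnt_mono (c : ℕ) : Monotone (cnt S c) := Nat.count_monotone _

theorem cnt_add (c a b : ℕ) : cnt S c (a + b) = cnt S c a + cnt (fun i => S (a + i)) c b :=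
  Nat.count_add _ _ _

theorem cnt_le (c a : ℕ) : cnt S c a ≤ a := Nat.count_le _

theorem off_succ (N c : ℕ) : off S N (c + 1) = off S N c + cnt S c N := by
  unfold off cnt
  induction N with
  | zero => simp
  | succ N ih =>
    rw [Nat.count_succ, Nat.count_succ, Nat.count_succ, ih]
    split_ifs <;> omega

theorem off_mono (N : ℕ) : Monotone (off S N) :=
  monotone_nat_of_le_succ fun c => by rw [off_succ]; omega

theorem off_zero (N : ℕ) : off S N 0 = 0 := by simp [off]

theorem off_eq {N d : ℕ} (h : ∀ y < N, S y < d) : off S N d = N := by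
  rw [off, Nat.count_iff_forall]
  exact fun {y} hy => h y hy

theorem cnt_lt {a b : ℕ} (h : a < b) : cnt S (S a) a < cnt S (S a) b :=
  Nat.count_strict_mono (p := fun y => S y = S a) rfl h

theorem pos_lt_of_lt {N x y : ℕ} (hx : x < N) (h : S x < S y) : pos S N x < pos S N y := by
  have h1 := off_mono (S := S) N (show S x + 1 ≤ S y from h)
  have h2 := cnt_lt (S := S) hx
  rw [off_succ] at h1
  unfold pos
  omega

theorem pos_lt_of_eq {N x y : ℕ} (h : S x = S y) (hxy : x < y) : pos S N x < pos S N y := by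
  have h2 := cnt_lt (S := S) hxy
  unfold pos
  rw [← h]
  omega

theorem pos_lt {N x : ℕ} (hx : x < N) : pos S N x < N := by
  have h2 := cnt_lt (S := S) hx
  have h3 : off S N (S x + 1) ≤ N := Nat.count_le _
  rw [off_succ] at h3
  unfold pos
  omega

/-- Stable sorting realises the lexicographic order of symbol and index. Together with
`perm_eq_of_lt_iff`, this reduces identities between sortings to comparisons of keys. -/
theorem pos_lt_iff {N x y : ℕ} (hx : x < N) (hy : y < N) :
    pos S N x < pos S N y ↔ S x < S y ∨ S x = S y ∧ x < y := by
  constructor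
  · intro h
    by_contra hc
    rcases lt_trichotomy (S y) (S x) with h1 | h1 | h1
    · exact absurd (pos_lt_of_lt hy h1) (by omega)
    · rcases lt_trichotomy x y with h2 | h2 | h2
      · exact hc (.inr ⟨h1.symm, h2⟩)
      · subst h2; exact lt_irrefl _ h
      · exact absurd (pos_lt_of_eq (N := N) h1 h2) (by omega)
    · exact hc (.inl h1)
  · rintro (h | ⟨h, h'⟩)
    · exact pos_lt_of_lt hx h
    · exact pos_lt_of_eq h h'

/-! ### Predecessor search in a monotone sequence -/

/-- The last index below `R` at which `e` is at most `q`. -/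
def pred (e : ℕ → ℕ) (R q : ℕ) : ℕ := Nat.findGreatest (fun r => e r ≤ q) (R - 1)

variable {e : ℕ → ℕ} {R : ℕ}

theorem pred_lt (hR : 0 < R) (q : ℕ) : pred e R q < R :=
  lt_of_le_of_lt (Nat.findGreatest_le _) (by omega)

theorem le_of_pred (h0 : e 0 = 0) (q : ℕ) : e (pred e R q) ≤ q :=
  Nat.findGreatest_spec (P := fun r => e r ≤ q) (Nat.zero_le _) (by simp [h0])

theorem lt_pred_succ (hR : 0 < R) {q : ℕ} (hq : q < e R) : q < e (pred e R q + 1) := by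
  by_contra hc
  have h1 := pred_lt (e := e) hR q
  rcases Nat.lt_or_ge (pred e R q + 1) R with h | h
  · have := Nat.le_findGreatest (P := fun r => e r ≤ q) (n := R - 1)
      (m := pred e R q + 1) (by omega) (by omega)
    unfold pred at *
    omega
  · have h2 : pred e R q + 1 = R := by omega
    rw [h2] at hc
    exact hc hq

theorem pred_mono (e : ℕ → ℕ) (R : ℕ) : Monotone (pred e R) := fun _ _ h =>
  Nat.findGreatest_mono (fun _ hr => le_trans hr h) le_rfl

/-- The explicit answers for the `u` queries that follow the end of a row. -/
def predFix (e : ℕ → ℕ) (R u a : ℕ) : ℕ :=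
  if a % (u + 1) = 0 then a / (u + 1)
  else pred e R (e (a / (u + 1) + 1) + (a % (u + 1) - 1))

/-- The sample point `u * (q / u)` is less than `u` below `q` and lies strictly before the end of
the row found for it, so `q` overshoots that end by less than `u`. -/
theorem pred_lookup_bound (hR : 0 < R) {u q : ℕ} (hu : 0 < u)
    (hq : q < e R) : q + 1 - e (pred e R (u * (q / u)) + 1) ≤ u := by
  have h1 := Nat.mul_div_le q u
  have h2 := lt_pred_succ (e := e) hR (lt_of_le_of_lt h1 hq)
  have h3 := Nat.div_add_mod q u
  have h4 := Nat.mod_lt q hu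
  omega

/-- Constant-time search: the row of the preceding sample is correct unless `q` lies past its end,
and then the answer is stored explicitly. The truncated difference is `0` exactly in the first case;
the `+ 1` moves overshoot zero to slot `1`. The cost is one sample per `u` places and `u + 1`
answers per row. -/
theorem pred_lookup (he : Monotone e) (h0 : e 0 = 0) (hR : 0 < R) {u q : ℕ} (hu : 0 < u)
    (hq : q < e R) :
    predFix e R u (pred e R (u * (q / u)) * (u + 1)
      + (q + 1 - e (pred e R (u * (q / u)) + 1))) = pred e R q := by
  have hb := pred_lookup_bound (e := e) hR hu hq
  have h1 := Nat.mul_div_le q u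
  have hm := pred_mono e R h1
  set r := pred e R (u * (q / u)) with hr
  have hd : (r * (u + 1) + (q + 1 - e (r + 1))) / (u + 1) = r := by
    rw [mul_comm, Nat.mul_add_div (by omega), Nat.div_eq_of_lt (by omega), add_zero]
  have hmod : (r * (u + 1) + (q + 1 - e (r + 1))) % (u + 1) = q + 1 - e (r + 1) := by
    rw [mul_comm, Nat.mul_add_mod, Nat.mod_eq_of_lt (by omega)]
  rw [predFix, hd, hmod]
  split_ifs with h
  · refine le_antisymm hm ?_
    by_contra hc
    have h2 := he (show r + 1 ≤ pred e R q by omega)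
    have h3 := le_of_pred (e := e) (R := R) h0 q
    omega
  · congr 1
    omega

/-! ### Two-level directories -/

/-- The place of the first occurrence of `r / K` in block `r % K`. -/
def rowStart (S : ℕ → ℕ) (K B r : ℕ) : ℕ :=
  off S (K * B) (r / K) + cnt S (r / K) (r % K * B)

/-- The number of occurrences of `r / K` in the first `j` chunks of block `r % K`. -/
def rowRank (S : ℕ → ℕ) (K B g r j : ℕ) : ℕ :=
  cnt (fun i => S (r % K * B + i)) (r / K) (j * g)

variable {K B g : ℕ}

theorem rowStart_mk {c t : ℕ} (ht : t < K) :
    rowStart S K B (c * K + t) = off S (K * B) c + cnt S c (t * B) := by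
  have h1 : (c * K + t) / K = c := by
    rw [mul_comm, Nat.mul_add_div (by omega), Nat.div_eq_of_lt ht, add_zero]
  have h2 : (c * K + t) % K = t := by rw [mul_comm, Nat.mul_add_mod, Nat.mod_eq_of_lt ht]
  rw [rowStart, h1, h2]

/-- Rows are ordered by symbol, then by block, as in the stable sorting, so consecutive rows tile
the places. After the last block the next row belongs to the next symbol, where `off_succ`
reconciles the two formulas. -/
theorem rowStart_succ (hK : 0 < K) (r : ℕ) :
    rowStart S K B (r + 1) = off S (K * B) (r / K) + cnt S (r / K) ((r % K + 1) * B) := by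
  have h1 := Nat.div_add_mod' r K
  have h2 := Nat.mod_lt r hK
  rcases Nat.lt_or_ge (r % K + 1) K with h | h
  · conv_lhs => rw [← h1, add_assoc, rowStart_mk h]
  · have h3 : r + 1 = (r / K + 1) * K + 0 := by rw [add_mul]; omega
    have h4 : r % K + 1 = K := by omega
    rw [h3, rowStart_mk hK, off_succ, h4]
    simp [cnt]

theorem rowStart_mono (hK : 0 < K) : Monotone (rowStart S K B) :=
  monotone_nat_of_le_succ fun r => by
    rw [rowStart_succ hK, rowStart]
    have := cnt_mono (S := S) (r / K) (show r % K * B ≤ (r % K + 1) * B by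
      exact Nat.mul_le_mul_right _ (by omega))
    omega

theorem rowStart_zero : rowStart S K B 0 = 0 := by simp [rowStart, off_zero, cnt]

theorem rowStart_end {d : ℕ} (hK : 0 < K) (h : ∀ y < K * B, S y < d) :
    rowStart S K B (d * K) = K * B := by
  rw [← add_zero (d * K), rowStart_mk hK, off_eq h]
  simp [cnt]

theorem rowRank_mono (r : ℕ) : Monotone (rowRank S K B g r) := fun _ _ h =>
  cnt_mono _ (Nat.mul_le_mul_right _ h)

theorem rowRank_zero (r : ℕ) : rowRank S K B g r 0 = 0 := by simp [rowRank, cnt]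

theorem rowRank_le {r G j : ℕ} (hj : j ≤ G) : rowRank S K (G * g) g r j ≤ G * g :=
  (cnt_le _ _).trans (Nat.mul_le_mul_right _ hj)

theorem rowStart_add_rowRank (hK : 0 < K) (G r : ℕ) :
    rowStart S K (G * g) r + rowRank S K (G * g) g r G = rowStart S K (G * g) (r + 1) := by
  rw [rowStart_succ hK, rowStart, rowRank, add_mul, one_mul, cnt_add, add_assoc]

/-- Evaluation of `pos` by block, chunk and position in the chunk. -/
theorem pos_eq {G x : ℕ} (hG : 0 < G) (hg : 0 < g) (hx : x < K * (G * g)) :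
    rowStart S K (G * g) (S x * K + x / (G * g))
      + rowRank S K (G * g) g (S x * K + x / (G * g)) (x % (G * g) / g)
      + cnt (fun i => S (x / g * g + i)) (S x) (x % g) = pos S (K * (G * g)) x := by
  have hB : 0 < G * g := Nat.mul_pos hG hg
  have ht : x / (G * g) < K := (Nat.div_lt_iff_lt_mul hB).2 hx
  have h1 : (S x * K + x / (G * g)) / K = S x := by
    rw [mul_comm, Nat.mul_add_div (Nat.zero_lt_of_lt ht), Nat.div_eq_of_lt ht, add_zero]
  have h2 : (S x * K + x / (G * g)) % K = x / (G * g) := by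
    rw [mul_comm, Nat.mul_add_mod, Nat.mod_eq_of_lt ht]
  have h3 : x / (G * g) * (G * g) + x % (G * g) / g * g = x / g * g := by
    have e1 := Nat.div_add_mod' x (G * g)
    have e2 := Nat.div_add_mod' x g
    have e3 := Nat.div_add_mod' (x % (G * g)) g
    rw [Nat.mod_mod_of_dvd _ (Dvd.intro_left G rfl)] at e3
    linarith
  rw [rowStart_mk ht, rowRank, h1, h2, add_assoc, add_assoc, ← add_assoc (cnt S _ _), ← cnt_add,
    h3, ← cnt_add, Nat.div_add_mod', pos]

/-- The position of occurrence number `q` of `c` in a string. -/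
noncomputable def sel (S : ℕ → ℕ) (c q : ℕ) : ℕ := Nat.nth (fun y => S y = c) q

theorem sel_spec {c q n : ℕ} (h : q < cnt S c n) :
    sel S c q < n ∧ S (sel S c q) = c ∧ cnt S c (sel S c q) = q := by
  have h1 : ∀ hf : {y | S y = c}.Finite, q < hf.toFinset.card := fun hf =>
    h.trans_le (Nat.count_le_card hf n)
  exact ⟨Nat.nth_lt_of_lt_count h, Nat.nth_mem q h1, Nat.count_nth h1⟩

/-- Inversion of `pos` by row, chunk and position in the chunk. -/
theorem pos_sel {G q r j : ℕ} (hK : 0 < K) (hG : 0 < G) (hg : 0 < g)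
    (hr : rowStart S K (G * g) r ≤ q)
    (hj : j < G) (hj1 : rowRank S K (G * g) g r j ≤ q - rowStart S K (G * g) r)
    (hj2 : q - rowStart S K (G * g) r < rowRank S K (G * g) g r (j + 1)) :
    sel (fun i => S ((r % K * G + j) * g + i)) (r / K)
        (q - rowStart S K (G * g) r - rowRank S K (G * g) g r j) < g ∧
    pos S (K * (G * g)) ((r % K * G + j) * g +
      sel (fun i => S ((r % K * G + j) * g + i)) (r / K)
        (q - rowStart S K (G * g) r - rowRank S K (G * g) g r j)) = q := by
  have hB : 0 < G * g := Nat.mul_pos hG hg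
  set q₁ := q - rowStart S K (G * g) r with hq₁
  -- The rank grows across chunk `j` by the occurrences inside it, so the residual rank is a valid
  -- argument of `sel` in that chunk.
  have h1 : rowRank S K (G * g) g r (j + 1) = rowRank S K (G * g) g r j
      + cnt (fun i => S ((r % K * G + j) * g + i)) (r / K) g := by
    have : ∀ i, (r % K * G + j) * g + i = r % K * (G * g) + (j * g + i) := fun i => by ring
    simp only [rowRank, add_mul j, one_mul, cnt_add (r / K) (j * g), this]
  obtain ⟨h2, h3, h4⟩ := sel_spec (S := fun i => S ((r % K * G + j) * g + i)) (c := r / K)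
    (q := q₁ - rowRank S K (G * g) g r j) (n := g) (by omega)
  refine ⟨h2, ?_⟩
  set z := sel (fun i => S ((r % K * G + j) * g + i)) (r / K) (q₁ - rowRank S K (G * g) g r j)
  have hx : r % K * (G * g) + (j * g + z) = (r % K * G + j) * g + z := by ring
  have hjz : j * g + z < G * g := by
    have := Nat.mul_le_mul_right g (show j + 1 ≤ G from hj)
    rw [add_mul] at this
    omega
  have hr2 := Nat.mod_lt r hK
  have e1 : ((r % K * G + j) * g + z) / (G * g) = r % K := by
    rw [← hx, mul_comm, Nat.mul_add_div hB, Nat.div_eq_of_lt hjz, add_zero]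
  have e2 : ((r % K * G + j) * g + z) % (G * g) = j * g + z := by
    rw [← hx, mul_comm, Nat.mul_add_mod, Nat.mod_eq_of_lt hjz]
  have e3 : (j * g + z) / g = j := by
    rw [mul_comm, Nat.mul_add_div hg, Nat.div_eq_of_lt h2, add_zero]
  have e4 : ((r % K * G + j) * g + z) / g = r % K * G + j := by
    rw [mul_comm, Nat.mul_add_div hg, Nat.div_eq_of_lt h2, add_zero]
  have e5 : ((r % K * G + j) * g + z) % g = z := by
    rw [mul_comm, Nat.mul_add_mod, Nat.mod_eq_of_lt h2]
  have hlt : (r % K * G + j) * g + z < K * (G * g) := by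
    have := Nat.mul_le_mul_right (G * g) (show r % K + 1 ≤ K from hr2)
    rw [add_mul] at this
    omega
  -- The candidate is verified by evaluating the forward formula at it.
  rw [← pos_eq hG hg hlt, e1, e2, e3, e4, e5]
  rw [h3, h4, Nat.div_add_mod']
  omega

end StableSort

namespace WordRAM

open StableSort WordRAM.Expr

/-! ### Layout of the memory -/

/-- The memory with consecutive regions of the sizes `sz` and the contents `f 0`, `f 1`, …. -/
def cat : List ℕ → (ℕ → ℕ → ℕ) → ℕ → ℕ
  | [], _, _ => 0
  | n :: l, f, a => if a < n then f 0 a else cat l (fun i => f (i + 1)) (a - n)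

/-- The address of region `j`. -/
def regionAddr (sz : List ℕ) (j : ℕ) : ℕ := (sz.take j).sum

theorem cat_regionAddr {sz : List ℕ} {j a : ℕ} (f : ℕ → ℕ → ℕ) (h : a < sz.getD j 0) :
    cat sz f (regionAddr sz j + a) = f j a := by
  induction sz generalizing j f with
  | nil => simp at h
  | cons n l ih =>
    cases j with
    | zero =>
      have h' : a < n := by simpa using h
      simp [cat, regionAddr, h']
    | succ j =>
      have h' : a < l.getD j 0 := by simpa using h
      have h2 := ih (j := j) (fun i => f (i + 1)) h'
      rw [regionAddr] at h2
      simp only [cat, regionAddr, List.take_succ_cons, List.sum_cons, add_assoc, h2,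
        Nat.add_sub_cancel_left]
      rw [if_neg (by omega)]

theorem regionAddr_add_lt {sz : List ℕ} {j a : ℕ} (h : a < sz.getD j 0) :
    regionAddr sz j + a < sz.sum := by
  induction sz generalizing j with
  | nil => simp at h
  | cons n l ih =>
    cases j with
    | zero =>
      have h' : a < n := by simpa using h
      simp [regionAddr]
      omega
    | succ j =>
      have h' : a < l.getD j 0 := by simpa using h
      have h2 := ih h'
      rw [regionAddr] at h2
      simp only [regionAddr, List.take_succ_cons, List.sum_cons]
      omega

/-- The parameters of the data structure: a string of `K * (G * g)` symbols less than `d` is cut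
into `K` blocks of `G` chunks of `g` symbols; chunks are coded by `b` bits and the local
directories use fields of `f` bits; predecessor search samples every `u₁`-th place globally and
every `u₂`-th place within a block. There are `k` levels on either side. -/
structure Layout where
  (w K G g d u₁ u₂ b f k : ℕ)

namespace Layout

variable (P : Layout)

/-- The number of symbols in a block. -/
def B : ℕ := P.G * P.g

/-- The number of symbols. -/
def N : ℕ := P.K * P.B

/-- The sizes of the regions of a level. -/
def levelSizes : List ℕ :=
  [P.K * P.G / (P.w / P.b) + 1, P.d * P.K + 1, P.N / P.u₁ + 1, P.d * P.K * (P.u₁ + 1),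
    P.d * P.K * (P.G + 1) / (P.w / P.f) + 1, P.d * P.K * (P.B / P.u₂ + 1) / (P.w / P.f) + 1,
    P.d * P.K * P.G * (P.u₂ + 1) / (P.w / P.f) + 1]

/-- The number of cells of a level. -/
def stride : ℕ := P.levelSizes.sum

/-- The sizes of the regions of the memory. -/
def sizes : List ℕ :=
  [28, 2 ^ P.b * P.g, 2 ^ P.b * P.g, 2 ^ P.b * P.d * P.g, 2 * P.k * P.stride]

/-- The number of cells of the memory. -/
def total : ℕ := P.sizes.sum

/-- The constants at the start of the memory. -/
def header : List ℕ :=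
  [2, P.k, regionAddr P.sizes 4, regionAddr P.sizes 4 + P.k * P.stride, P.stride,
    P.g, P.B, P.K, P.G, P.d, P.u₁, P.u₂, P.b, 2 ^ P.b, P.w / P.b, P.f, 2 ^ P.f, P.w / P.f,
    regionAddr P.sizes 1, regionAddr P.sizes 2, regionAddr P.sizes 3,
    regionAddr P.levelSizes 1, regionAddr P.levelSizes 2, regionAddr P.levelSizes 3,
    regionAddr P.levelSizes 4, regionAddr P.levelSizes 5, regionAddr P.levelSizes 6,
    P.B / P.u₂ + 1]

/-- Digit `i` of the chunk code `v`. -/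
def digit (v i : ℕ) : ℕ := v / P.d ^ i % P.d

/-- The cell that packs fields number `a * (w / b)`, …. -/
def packCell (b : ℕ) (fld : ℕ → ℕ) (a : ℕ) : ℕ :=
  code (2 ^ b) (P.w / b) fun y => fld (a * (P.w / b) + y)

/-- The code of chunk `j`. -/
def chunkField (S : ℕ → ℕ) (j : ℕ) : ℕ := code P.d P.g fun i => S (j * P.g + i)

/-- The directory of ranks within the blocks. -/
def rankField (S : ℕ → ℕ) (a : ℕ) : ℕ :=
  rowRank S P.K P.B P.g (a / (P.G + 1)) (a % (P.G + 1))

/-- The samples for the search within the blocks. -/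
def sampleField (S : ℕ → ℕ) (a : ℕ) : ℕ :=
  pred (rowRank S P.K P.B P.g (a / (P.B / P.u₂ + 1))) P.G (P.u₂ * (a % (P.B / P.u₂ + 1)))

/-- The explicit answers for the search within the blocks. -/
def fixField (S : ℕ → ℕ) (a : ℕ) : ℕ :=
  predFix (rowRank S P.K P.B P.g (a / (P.G * (P.u₂ + 1)))) P.G P.u₂ (a % (P.G * (P.u₂ + 1)))

/-- The contents of the regions of a level that represents the string `S`. -/
def levelRegion (S : ℕ → ℕ) (j a : ℕ) : ℕ :=
  match j with
  | 0 => P.packCell P.b (P.chunkField S) a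
  | 1 => rowStart S P.K P.B a
  | 2 => pred (rowStart S P.K P.B) (P.d * P.K) (P.u₁ * a)
  | 3 => predFix (rowStart S P.K P.B) (P.d * P.K) P.u₁ a
  | 4 => P.packCell P.f (P.rankField S) a
  | 5 => P.packCell P.f (P.sampleField S) a
  | _ => P.packCell P.f (P.fixField S) a

/-- The contents of the regions of the memory; level `l` represents the string `S l`. -/
noncomputable def region (S : ℕ → ℕ → ℕ) (j a : ℕ) : ℕ :=
  match j with
  | 0 => P.header.getD a 0
  | 1 => P.digit (a / P.g) (a % P.g)
  | 2 => cnt (P.digit (a / P.g)) (P.digit (a / P.g) (a % P.g)) (a % P.g)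
  | 3 => sel (P.digit (a / P.g / P.d)) (a / P.g % P.d) (a % P.g)
  | _ => cat P.levelSizes (P.levelRegion (S (a / P.stride))) (a % P.stride)

/-- The contents of the memory. -/
noncomputable def image (S : ℕ → ℕ → ℕ) : ℕ → ℕ := cat P.sizes (P.region S)

/-- The conditions under which the queries are answered. -/
structure Valid : Prop where
  K_pos : 0 < P.K
  G_pos : 0 < P.G
  g_pos : 0 < P.g
  d_pos : 0 < P.d
  u₁_pos : 0 < P.u₁
  u₂_pos : 0 < P.u₂
  b_pos : 0 < P.b
  f_pos : 0 < P.f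
  b_lt : P.b < P.w
  f_lt : P.f < P.w
  code_le : P.d ^ P.g ≤ 2 ^ P.b
  B_lt : P.B < 2 ^ P.f
  N_lt : P.N < 2 ^ P.w
  total_le : P.total ≤ 2 ^ P.w
  rank_le : P.d * P.K * (P.G + 1) ≤ 2 ^ P.w
  sample_le : P.d * P.K * (P.B / P.u₂ + 1) ≤ 2 ^ P.w
  fix_le : P.d * P.K * P.G * (P.u₂ + 1) ≤ 2 ^ P.w

end Layout

/-! ### The expressions that evaluate a level -/

/-- The header constant number `i`. -/
def hd (i : ℕ) : Expr := .load (.const i)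

/-- The cell of region number `i - 20` of the level based at `lv`. -/
def levelCell (lv : Expr) (i : ℕ) (a : Expr) : Expr := .load (lv + hd i + a)

/-- A field of a local directory of the level based at `lv`. -/
def levelField (lv : Expr) (i : ℕ) (a : Expr) : Expr :=
  fieldExpr (lv + hd i) a (hd 15) (hd 16) (hd 17)

/-- The code of chunk `j`. -/
def chunkExpr (lv j : Expr) : Expr := fieldExpr lv j (hd 12) (hd 13) (hd 14)

/-- The place of position `x` in the stable sorting of the level based at `lv`. -/
def posExpr (lv x : Expr) : Expr :=
  let z := chunkExpr lv (x / hd 5) * hd 5 + x % hd 5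
  let r := .load (hd 18 + z) * hd 7 + x / hd 6
  levelCell lv 21 r + levelField lv 24 (r * (hd 8 + .const 1) + x % hd 6 / hd 5)
    + .load (hd 19 + z)

/-- The row that contains the place `q`. -/
def rowExpr (lv q : Expr) : Expr :=
  let r := levelCell lv 22 (q / hd 10)
  levelCell lv 23 (r * (hd 10 + .const 1)
    + monus (q + .const 1) (levelCell lv 21 (r + .const 1)))

/-- The chunk of row `r` that contains occurrence number `q`. -/
def chunkSelExpr (lv r q : Expr) : Expr :=
  let j := levelField lv 25 (r * hd 27 + q / hd 11)
  levelField lv 26 (r * (hd 8 * (hd 11 + .const 1)) + (j * (hd 11 + .const 1)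
    + monus (q + .const 1) (levelField lv 24 (r * (hd 8 + .const 1) + (j + .const 1)))))

/-- The position at place `q` in the stable sorting of the level based at `lv`. -/
def posInvExpr (lv q : Expr) : Expr :=
  let r := rowExpr lv q
  let q₁ := q - levelCell lv 21 r
  let j := chunkSelExpr lv r q₁
  let q₂ := q₁ - levelField lv 24 (r * (hd 8 + .const 1) + j)
  let J := r % hd 7 * hd 8 + j
  J * hd 5 + .load (hd 20 + ((chunkExpr lv J * hd 9 + r / hd 7) * hd 5 + q₂))

/-! ### Correctness of the queries on one level -/

/-- In the state `s`, whose memory is given by `img`, the level at address `l` represents `S`. -/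
structure Represents (P : Layout) (s : State P.w) (img : ℕ → ℕ) (S : ℕ → ℕ) (l : ℕ) : Prop where
  holds : s.Holds img P.total
  header : ∀ i < 28, img i = P.header.getD i 0
  table : ∀ j, 1 ≤ j → j ≤ 3 → ∀ a < P.sizes.getD j 0,
    img (regionAddr P.sizes j + a) = P.region (fun _ => S) j a
  level : ∀ j a, a < P.levelSizes.getD j 0 → l + regionAddr P.levelSizes j + a < P.total ∧
    img (l + regionAddr P.levelSizes j + a) = P.levelRegion S j a
  lt : ∀ y < P.N, S y < P.d

namespace Represents

variable {P : Layout} {s : State P.w} {img : ℕ → ℕ} {S : ℕ → ℕ} {l : ℕ} {lv : Expr}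

theorem ev_hd (h : Represents P s img S l) {i : ℕ} (hi : i < 28) :
    (hd i).Ev s (P.header.getD i 0) := by
  have h1 : i < P.total := by
    have := regionAddr_add_lt (sz := P.sizes) (j := 0) (a := i) hi
    rw [regionAddr, List.take_zero, List.sum_nil, zero_add] at this
    exact this
  exact ((ev_const i).load h.holds h1).congr (h.header i hi)

theorem ev_levelCell (h : Represents P s img S l) (hl : lv.Ev s l) {j : ℕ} (hj : j < 7)
    (hj0 : 0 < j) {a : Expr} {x : ℕ} (ha : a.Ev s x) (hx : x < P.levelSizes.getD j 0) :
    (levelCell lv (20 + j) a).Ev s (P.levelRegion S j x) := by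
  have h1 : P.header.getD (20 + j) 0 = regionAddr P.levelSizes j := by
    interval_cases j <;> rfl
  obtain ⟨h2, h3⟩ := h.level j x hx
  exact (((hl.add (h.ev_hd (i := 20 + j) (by omega))).add ha).load h.holds
    (by rw [h1]; exact h2)).congr (by rw [h1]; exact h3)

theorem ev_levelField (h : Represents P s img S l) (hP : P.Valid) (hl : lv.Ev s l) {j : ℕ}
    (hj : j < 7) (hj0 : 0 < j) {a : Expr} {x n : ℕ} {fld : ℕ → ℕ} (ha : a.Ev s x) (hx : x < n)
    (hn : n ≤ 2 ^ P.w) (hsz : P.levelSizes.getD j 0 = n / (P.w / P.f) + 1)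
    (hfld : P.levelRegion S j = P.packCell P.f fld) (hv : fld x < 2 ^ P.f) :
    (levelField lv (20 + j) a).Ev s (fld x) := by
  have h1 : P.header.getD (20 + j) 0 = regionAddr P.levelSizes j := by
    interval_cases j <;> rfl
  obtain ⟨h2, h3⟩ := h.level j (x / (P.w / P.f)) (by
    rw [hsz]; exact Nat.lt_succ_of_le (Nat.div_le_div_right hx.le))
  have hb := (hl.add (h.ev_hd (i := 20 + j) (by omega)))
  rw [h1] at hb
  exact ev_field h.holds hb ha (h.ev_hd (i := 15) (by norm_num))
    (h.ev_hd (i := 16) (by norm_num)) (h.ev_hd (i := 17) (by norm_num)) hP.f_pos hP.f_lt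
    (hx.trans_le hn) h2 (h3.trans (by rw [hfld]; rfl)) hv

theorem g_le_B (hP : P.Valid) : P.g ≤ P.B := Nat.le_mul_of_pos_left _ hP.G_pos

theorem B_le_N (hP : P.Valid) : P.B ≤ P.N := Nat.le_mul_of_pos_left _ hP.K_pos

theorem B_pos (hP : P.Valid) : 0 < P.B := Nat.mul_pos hP.G_pos hP.g_pos

theorem rows_pos (hP : P.Valid) : 0 < P.d * P.K := Nat.mul_pos hP.d_pos hP.K_pos

theorem ev_chunk (h : Represents P s img S l) (hP : P.Valid) (hl : lv.Ev s l)
    {j : Expr} {x : ℕ} (hj : j.Ev s x) (hx : x < P.K * P.G) :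
    (chunkExpr lv j).Ev s (P.chunkField S x) := by
  obtain ⟨h2, h3⟩ := h.level 0 (x / (P.w / P.b)) (by
    exact Nat.lt_succ_of_le (Nat.div_le_div_right hx.le))
  have hx2 : x < P.N := hx.trans_le (by
    rw [Layout.N, Layout.B, ← mul_assoc]
    exact Nat.le_mul_of_pos_right _ hP.g_pos)
  exact ev_field h.holds hl hj (h.ev_hd (i := 12) (by norm_num))
    (h.ev_hd (i := 13) (by norm_num)) (h.ev_hd (i := 14) (by norm_num)) hP.b_pos hP.b_lt
    (hx2.trans hP.N_lt) h2 h3 ((code_lt hP.d_pos _ _).trans_le hP.code_le)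

theorem digit_chunk (h : Represents P s img S l) (hP : P.Valid) {j i : ℕ} (hj : j < P.K * P.G)
    (hi : i < P.g) : P.digit (P.chunkField S j) i = S (j * P.g + i) := by
  rw [Layout.digit, Layout.chunkField, code_digit hP.d_pos hi, Nat.mod_eq_of_lt]
  apply h.lt
  rw [Layout.N, Layout.B, ← mul_assoc]
  calc j * P.g + i < j * P.g + P.g := by omega
    _ = (j + 1) * P.g := by ring
    _ ≤ P.K * P.G * P.g := Nat.mul_le_mul_right _ hj

theorem cnt_congr {T U : ℕ → ℕ} {n : ℕ} (hTU : ∀ i < n, T i = U i) (c : ℕ) :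
    cnt T c n = cnt U c n := by
  unfold cnt
  induction n with
  | zero => rfl
  | succ n ih =>
    rw [Nat.count_succ, Nat.count_succ, ih fun i hi => hTU i (by omega), hTU n (by omega)]

/-- `sel` refers to an infinite string, whereas a chunk code determines only `g` symbols. Agreement
on a prefix suffices when the wanted occurrence lies in that prefix. -/
theorem sel_congr {T U : ℕ → ℕ} {n q c : ℕ} (hTU : ∀ i < n, T i = U i) (hq : q < cnt U c n) :
    sel T c q = sel U c q := by
  obtain ⟨h1, h2, h3⟩ := sel_spec hq
  obtain ⟨h4, h5, h6⟩ := sel_spec (S := T) (hq.trans_eq (cnt_congr hTU c).symm)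
  refine Nat.count_injective (p := fun y => U y = c) ?_ h2 ?_
  · exact (hTU _ h4).symm.trans h5
  · refine Eq.trans ?_ h3.symm
    refine Eq.trans ?_ h6
    exact cnt_congr (fun i hi => (hTU i (by omega)).symm) c

theorem tableIndex_lt {b g v i : ℕ} (hv : v < b) (hi : i < g) : v * g + i < b * g := by
  calc v * g + i < v * g + g := by omega
    _ = (v + 1) * g := by ring
    _ ≤ b * g := Nat.mul_le_mul_right _ hv

theorem mul_add_div_of_lt {g v i : ℕ} (hi : i < g) : (v * g + i) / g = v := by
  rw [mul_comm, Nat.mul_add_div (by omega), Nat.div_eq_of_lt hi, add_zero]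

theorem mul_add_mod_of_lt {g v i : ℕ} (hi : i < g) : (v * g + i) % g = i := by
  rw [mul_comm, Nat.mul_add_mod, Nat.mod_eq_of_lt hi]

theorem rankField_lt (hP : P.Valid) {r j : ℕ} (hj : j ≤ P.G) :
    P.rankField S (r * (P.G + 1) + j) = rowRank S P.K P.B P.g r j ∧
      P.rankField S (r * (P.G + 1) + j) < 2 ^ P.f := by
  have h1 : P.rankField S (r * (P.G + 1) + j) = rowRank S P.K P.B P.g r j := by
    rw [Layout.rankField, mul_add_div_of_lt (by omega), mul_add_mod_of_lt (by omega)]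
  exact ⟨h1, h1 ▸ (rowRank_le hj).trans_lt hP.B_lt⟩

theorem ev_rank (h : Represents P s img S l) (hP : P.Valid) (hl : lv.Ev s l)
    {a b : Expr} {r j : ℕ} (ha : a.Ev s r) (hb : b.Ev s j) (hr : r < P.d * P.K)
    (hj : j ≤ P.G) :
    (levelField lv 24 (a * (hd 8 + .const 1) + b)).Ev s (rowRank S P.K P.B P.g r j) := by
  obtain ⟨h1, h2⟩ := rankField_lt (S := S) hP (r := r) hj
  have h3 := (ha.mul ((h.ev_hd (i := 8) (by norm_num)).add (ev_const 1))).add hb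
  exact (h.ev_levelField hP hl (j := 4) (by norm_num) (by norm_num) h3
    (tableIndex_lt hr (Nat.lt_succ_of_le hj)) hP.rank_le rfl rfl h2).congr h1

theorem ev_rowStart (h : Represents P s img S l) (hl : lv.Ev s l)
    {a : Expr} {r : ℕ} (ha : a.Ev s r) (hr : r ≤ P.d * P.K) :
    (levelCell lv 21 a).Ev s (rowStart S P.K P.B r) :=
  h.ev_levelCell hl (j := 1) (by norm_num) (by norm_num) ha (Nat.lt_succ_of_le hr)

/-- This is `pos_eq` read from memory: the chunk code indexes tables for the symbol at `x` and for
its rank inside the chunk, and the symbol selects the row of the two directories. -/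
theorem ev_pos (h : Represents P s img S l) (hP : P.Valid) (hl : lv.Ev s l)
    {e : Expr} {x : ℕ} (he : e.Ev s x) (hx : x < P.N) :
    (posExpr lv e).Ev s (pos S P.N x) := by
  have hxw := hx.trans hP.N_lt
  have hBN := B_le_N hP
  have hBw := hBN.trans_lt hP.N_lt
  have hgB := g_le_B hP
  have hgw := hgB.trans_lt hBw
  have hi := Nat.mod_lt x hP.g_pos
  have hjK : x / P.g < P.K * P.G := (Nat.div_lt_iff_lt_mul hP.g_pos).2 (by
    rw [mul_assoc]; exact hx)
  have htK : x / P.B < P.K := (Nat.div_lt_iff_lt_mul (B_pos hP)).2 hx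
  have hc := h.lt x hx
  have hr : S x * P.K + x / P.B < P.d * P.K := tableIndex_lt hc htK
  have hj : x % P.B / P.g < P.G := (Nat.div_lt_iff_lt_mul hP.g_pos).2 (Nat.mod_lt _ (B_pos hP))
  have hv : P.chunkField S (x / P.g) < 2 ^ P.b := (code_lt hP.d_pos _ _).trans_le hP.code_le
  have hdig : ∀ i < P.g, P.digit (P.chunkField S (x / P.g)) i = S (x / P.g * P.g + i) :=
    fun i hi => h.digit_chunk hP hjK hi
  have hg' := h.ev_hd (i := 5) (by norm_num)
  have hz := ((h.ev_chunk hP hl (he.div hg' hxw hgw) hjK).mul hg').add (he.mod hg' hxw hgw)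
  change Ev s _ (P.chunkField S (x / P.g) * P.g + x % P.g) at hz
  have hsz := tableIndex_lt hv hi
  have e1 := (((h.ev_hd (i := 18) (by norm_num)).add hz).load h.holds
    (regionAddr_add_lt (sz := P.sizes) (j := 1) hsz)).congr
      (y := S x) (by
        refine (h.table 1 (by norm_num) (by norm_num) _ hsz).trans ?_
        simp only [Layout.region]
        rw [mul_add_div_of_lt hi, mul_add_mod_of_lt hi, hdig _ hi, Nat.div_add_mod'])
  have e2 := (((h.ev_hd (i := 19) (by norm_num)).add hz).load h.holds
    (regionAddr_add_lt (sz := P.sizes) (j := 2) hsz)).congr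
      (y := cnt (fun i => S (x / P.g * P.g + i)) (S x) (x % P.g)) (by
        refine (h.table 2 (by norm_num) (by norm_num) _ hsz).trans ?_
        simp only [Layout.region]
        rw [mul_add_div_of_lt hi, mul_add_mod_of_lt hi, hdig _ hi, Nat.div_add_mod']
        exact cnt_congr (fun i hi' => hdig i (hi'.trans hi)) _)
  have er := (e1.mul (h.ev_hd (i := 7) (by norm_num))).add
    (he.div (h.ev_hd (i := 6) (by norm_num)) hxw hBw)
  have ej := (he.mod (h.ev_hd (i := 6) (by norm_num)) hxw hBw).div hg'
    ((Nat.mod_le _ _).trans_lt hxw) hgw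
  refine (((h.ev_rowStart hl er hr.le).add (h.ev_rank hP hl er ej hr hj.le)).add e2).congr ?_
  exact pos_eq hP.G_pos hP.g_pos hx

theorem rowStart_rows (h : Represents P s img S l) (hP : P.Valid) :
    rowStart S P.K P.B (P.d * P.K) = P.N := rowStart_end hP.K_pos h.lt

theorem ev_row (h : Represents P s img S l) (hP : P.Valid) (hl : lv.Ev s l)
    {e : Expr} {q : ℕ} (he : e.Ev s q) (hq : q < P.N) :
    (rowExpr lv e).Ev s (pred (rowStart S P.K P.B) (P.d * P.K) q) := by
  have hR := rows_pos hP
  have hqR : q < rowStart S P.K P.B (P.d * P.K) := by rwa [h.rowStart_rows hP]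
  have hmono := rowStart_mono (S := S) (B := P.B) hP.K_pos
  -- The region of explicit answers has more than `u₁` cells, so `u₁` is a word because the whole
  -- memory is addressable.
  have hu : P.u₁ < 2 ^ P.w := by
    refine lt_of_lt_of_le ?_ hP.total_le
    have h1 : P.u₁ < P.d * P.K * (P.u₁ + 1) :=
      lt_of_lt_of_le (Nat.lt_succ_self _) (Nat.le_mul_of_pos_left _ hR)
    obtain ⟨h2, -⟩ := h.level 3 P.u₁ h1
    omega
  have hq1 := pred_lt (e := rowStart S P.K P.B) hR (P.u₁ * (q / P.u₁))
  have e0 := h.ev_levelCell hl (j := 2) (by norm_num) (by norm_num)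
    (he.div (h.ev_hd (i := 10) (by norm_num)) (hq.trans hP.N_lt) hu)
    (Nat.lt_succ_of_le (Nat.div_le_div_right hq.le))
  change Ev s _ (pred (rowStart S P.K P.B) (P.d * P.K) (P.u₁ * (q / P.u₁))) at e0
  have e1 := h.ev_rowStart hl (e0.add (ev_const 1)) hq1
  have hle := hmono (show pred (rowStart S P.K P.B) (P.d * P.K) (P.u₁ * (q / P.u₁)) + 1
    ≤ P.d * P.K from hq1)
  rw [h.rowStart_rows hP] at hle
  have e2 := (he.add (ev_const 1)).monus e1 (lt_of_le_of_lt hq hP.N_lt)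
    (hle.trans_lt hP.N_lt)
  have e3 := (e0.mul ((h.ev_hd (i := 10) (by norm_num)).add (ev_const 1))).add e2
  exact (h.ev_levelCell hl (j := 3) (by norm_num) (by norm_num) e3
    (tableIndex_lt hq1 (Nat.lt_succ_of_le (pred_lookup_bound hR hP.u₁_pos hqR)))).congr
    (pred_lookup hmono rowStart_zero hR hP.u₁_pos hqR)

theorem ev_chunkSel (h : Represents P s img S l) (hP : P.Valid) (hl : lv.Ev s l)
    {a e : Expr} {r q : ℕ} (ha : a.Ev s r) (hr : r < P.d * P.K) (he : e.Ev s q)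
    (hq : q < rowRank S P.K P.B P.g r P.G) :
    (chunkSelExpr lv a e).Ev s (pred (rowRank S P.K P.B P.g r) P.G q) := by
  have hmono := rowRank_mono (S := S) (K := P.K) (B := P.B) (g := P.g) r
  have hBf : P.B < 2 ^ P.w :=
    hP.B_lt.trans (Nat.pow_lt_pow_right (by norm_num) hP.f_lt)
  have hqB : q < P.B := hq.trans_le (rowRank_le le_rfl)
  have hGB : P.G ≤ P.B := Nat.le_mul_of_pos_right _ hP.g_pos
  have hu : P.u₂ < 2 ^ P.w := by
    refine lt_of_lt_of_le ?_ hP.fix_le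
    exact lt_of_lt_of_le (Nat.lt_succ_self _)
      (Nat.le_mul_of_pos_left _ (Nat.mul_pos (rows_pos hP) hP.G_pos))
  have hγ : q / P.u₂ < P.B / P.u₂ + 1 := Nat.lt_succ_of_le (Nat.div_le_div_right hqB.le)
  have hq1 := pred_lt (e := rowRank S P.K P.B P.g r) hP.G_pos (P.u₂ * (q / P.u₂))
  have e0 := h.ev_levelField hP hl (j := 5) (by norm_num) (by norm_num)
    ((ha.mul (h.ev_hd (i := 27) (by norm_num))).add
      (he.div (h.ev_hd (i := 11) (by norm_num)) (hqB.trans hBf) hu))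
    (tableIndex_lt hr hγ) hP.sample_le rfl (fld := P.sampleField S) rfl
    ((pred_lt hP.G_pos _).trans_le (hGB.trans hP.B_lt.le))
  have v0 : P.sampleField S (r * (P.B / P.u₂ + 1) + q / P.u₂)
      = pred (rowRank S P.K P.B P.g r) P.G (P.u₂ * (q / P.u₂)) := by
    rw [Layout.sampleField, mul_add_div_of_lt hγ, mul_add_mod_of_lt hγ]
  replace e0 := e0.congr v0
  have e1 := h.ev_rank hP hl ha (e0.add (ev_const 1)) hr hq1
  have e2 := (he.add (ev_const 1)).monus e1 (lt_of_le_of_lt hqB hBf)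
    ((rowRank_le hq1).trans_lt hBf)
  have hb := tableIndex_lt hq1 (Nat.lt_succ_of_le (pred_lookup_bound hP.G_pos hP.u₂_pos hq))
  have e3 := (e0.mul ((h.ev_hd (i := 11) (by norm_num)).add (ev_const 1))).add e2
  have e4 := (ha.mul ((h.ev_hd (i := 8) (by norm_num)).mul
    ((h.ev_hd (i := 11) (by norm_num)).add (ev_const 1)))).add e3
  have hlt := tableIndex_lt hr hb
  have v1 : P.fixField S (r * (P.G * (P.u₂ + 1))
      + (pred (rowRank S P.K P.B P.g r) P.G (P.u₂ * (q / P.u₂)) * (P.u₂ + 1)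
        + (q + 1 - rowRank S P.K P.B P.g r
          (pred (rowRank S P.K P.B P.g r) P.G (P.u₂ * (q / P.u₂)) + 1))))
      = pred (rowRank S P.K P.B P.g r) P.G q := by
    rw [Layout.fixField, mul_add_div_of_lt hb, mul_add_mod_of_lt hb]
    exact pred_lookup hmono (rowRank_zero r) hP.G_pos hP.u₂_pos hq
  refine (h.ev_levelField hP hl (j := 6) (by norm_num) (by norm_num) e4
    (by rw [mul_assoc (P.d * P.K)]; exact hlt) hP.fix_le rfl (fld := P.fixField S) rfl ?_).congr v1
  change P.fixField S (r * (P.G * (P.u₂ + 1))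
      + (pred (rowRank S P.K P.B P.g r) P.G (P.u₂ * (q / P.u₂)) * (P.u₂ + 1)
        + (q + 1 - rowRank S P.K P.B P.g r
          (pred (rowRank S P.K P.B P.g r) P.G (P.u₂ * (q / P.u₂)) + 1)))) < _
  rw [v1]
  exact (pred_lt hP.G_pos _).trans_le (hGB.trans hP.B_lt.le)

/-- One predecessor search finds the row, a second one finds the chunk in the row, and a table
indexed by chunk code, symbol and residual rank finds the position; `pos_sel` justifies the result.
-/
theorem ev_posInv (h : Represents P s img S l) (hP : P.Valid) (hl : lv.Ev s l)
    {e : Expr} {q : ℕ} (he : e.Ev s q) (hq : q < P.N) :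
    ∃ x < P.N, pos S P.N x = q ∧ (posInvExpr lv e).Ev s x := by
  have hR := rows_pos hP
  have hqR : q < rowStart S P.K P.B (P.d * P.K) := by rwa [h.rowStart_rows hP]
  have er := h.ev_row hP hl he hq
  have hr := pred_lt (e := rowStart S P.K P.B) hR q
  have hr1 := le_of_pred (e := rowStart S P.K P.B) (R := P.d * P.K) rowStart_zero q
  have hr2 := lt_pred_succ (e := rowStart S P.K P.B) hR hqR
  set r := pred (rowStart S P.K P.B) (P.d * P.K) q
  have e1 := he.sub (h.ev_rowStart hl er hr.le) hr1
  have hend := rowStart_add_rowRank (S := S) (g := P.g) hP.K_pos P.G r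
  have hq1 : q - rowStart S P.K P.B r < rowRank S P.K P.B P.g r P.G := by
    change rowStart S P.K P.B r + rowRank S P.K P.B P.g r P.G = rowStart S P.K P.B (r + 1) at hend
    change q < rowStart S P.K P.B (r + 1) at hr2
    omega
  have ej := h.ev_chunkSel hP hl er hr e1 hq1
  have hj := pred_lt (e := rowRank S P.K P.B P.g r) hP.G_pos (q - rowStart S P.K P.B r)
  have hj1 := le_of_pred (e := rowRank S P.K P.B P.g r) (R := P.G) (rowRank_zero r)
    (q - rowStart S P.K P.B r)
  have hj2 := lt_pred_succ (e := rowRank S P.K P.B P.g r) hP.G_pos hq1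
  set j := pred (rowRank S P.K P.B P.g r) P.G (q - rowStart S P.K P.B r)
  obtain ⟨hz, hx⟩ := pos_sel hP.K_pos hP.G_pos hP.g_pos hr1 hj hj1 hj2
  have e2 := e1.sub (h.ev_rank hP hl er ej hr hj.le) hj1
  have hKN : P.K ≤ P.N := Nat.le_mul_of_pos_right _ (B_pos hP)
  have hKw := hKN.trans_lt hP.N_lt
  have hrw : r < 2 ^ P.w := hr.trans_le (le_trans (Nat.le_mul_of_pos_right _ (by omega))
    hP.rank_le)
  have eJ := ((er.mod (h.ev_hd (i := 7) (by norm_num)) hrw hKw).mul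
    (h.ev_hd (i := 8) (by norm_num))).add ej
  change Ev s _ (r % P.K * P.G + j) at eJ
  have hJ : r % P.K * P.G + j < P.K * P.G := tableIndex_lt (Nat.mod_lt _ hP.K_pos) hj
  have hv : P.chunkField S (r % P.K * P.G + j) < 2 ^ P.b :=
    (code_lt hP.d_pos _ _).trans_le hP.code_le
  have hdig : ∀ i < P.g, P.digit (P.chunkField S (r % P.K * P.G + j)) i
      = S ((r % P.K * P.G + j) * P.g + i) := fun i hi => h.digit_chunk hP hJ hi
  have hc : r / P.K < P.d := (Nat.div_lt_iff_lt_mul hP.K_pos).2 hr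
  have hcnt : q - rowStart S P.K P.B r - rowRank S P.K P.B P.g r j
      < cnt (fun i => S ((r % P.K * P.G + j) * P.g + i)) (r / P.K) P.g := by
    have : ∀ i, (r % P.K * P.G + j) * P.g + i = r % P.K * (P.G * P.g) + (j * P.g + i) :=
      fun i => by ring
    have h1 : rowRank S P.K P.B P.g r (j + 1) = rowRank S P.K P.B P.g r j
        + cnt (fun i => S ((r % P.K * P.G + j) * P.g + i)) (r / P.K) P.g := by
      simp only [rowRank, add_mul j, one_mul, cnt_add (r / P.K) (j * P.g), this, Layout.B]
    omega
  have hq2 := hcnt.trans_le (cnt_le _ _)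
  have hidx := tableIndex_lt (tableIndex_lt hv hc) hq2
  have et := (((h.ev_chunk hP hl eJ hJ).mul (h.ev_hd (i := 9) (by norm_num))).add
    (er.div (h.ev_hd (i := 7) (by norm_num)) hrw hKw)).mul
    (h.ev_hd (i := 5) (by norm_num)) |>.add e2
  have e3 := (((h.ev_hd (i := 20) (by norm_num)).add et).load h.holds
    (regionAddr_add_lt (sz := P.sizes) (j := 3) hidx)).congr
      (y := sel (fun i => S ((r % P.K * P.G + j) * P.g + i)) (r / P.K)
        (q - rowStart S P.K P.B r - rowRank S P.K P.B P.g r j)) (by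
        refine (h.table 3 (by norm_num) (by norm_num) _ hidx).trans ?_
        simp only [Layout.region]
        rw [mul_add_div_of_lt hq2, mul_add_mod_of_lt hq2, mul_add_div_of_lt hc,
          mul_add_mod_of_lt hc]
        exact sel_congr hdig hcnt)
  refine ⟨_, ?_, hx, (eJ.mul (h.ev_hd (i := 5) (by norm_num))).add e3⟩
  rw [Layout.N, Layout.B, ← mul_assoc]
  exact tableIndex_lt hJ hz

end Represents

theorem Layout.represents {P : Layout} {s : State P.w} {S : ℕ → ℕ → ℕ}
    (hs : s.Holds (P.image S) P.total) (hS : ∀ l < 2 * P.k, ∀ y < P.N, S l y < P.d)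
    {l : ℕ} (hl : l < 2 * P.k) :
    Represents P s (P.image S) (S l) (regionAddr P.sizes 4 + l * P.stride) where
  holds := hs
  header i hi := by
    have := cat_regionAddr (sz := P.sizes) (j := 0) (P.region S) (a := i) hi
    rw [regionAddr, List.take_zero, List.sum_nil, zero_add] at this
    exact this
  table j h1 h3 a ha := by
    refine (cat_regionAddr (P.region S) ha).trans ?_
    interval_cases j <;> rfl
  level j a ha := by
    have h1 := regionAddr_add_lt ha
    have h2 : l * P.stride + (regionAddr P.levelSizes j + a) < P.sizes.getD 4 0 :=
      Represents.tableIndex_lt hl h1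
    rw [add_assoc, add_assoc]
    refine ⟨regionAddr_add_lt h2, (cat_regionAddr (P.region S) h2).trans ?_⟩
    change cat P.levelSizes (P.levelRegion (S ((l * P.stride + _) / P.stride)))
      ((l * P.stride + _) % P.stride) = _
    rw [Represents.mul_add_div_of_lt (show _ < P.stride from h1),
      Represents.mul_add_mod_of_lt (show _ < P.stride from h1), cat_regionAddr _ ha]
  lt := hS l hl

/-! ### Sweeping through the levels -/

/-- The composition of the stable sortings by the first `k` strings. -/
def sortChain (S : ℕ → ℕ → ℕ) (N : ℕ) : ℕ → ℕ → ℕ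
  | 0, x => x
  | l + 1, x => pos (S l) N (sortChain S N l x)

theorem sortChain_lt {S : ℕ → ℕ → ℕ} {N x : ℕ} (hx : x < N) (l : ℕ) :
    sortChain S N l x < N := by
  induction l with
  | zero => exact hx
  | succ l ih => exact pos_lt ih

/-- The base of the current level in the group whose address is header constant `i`. -/
def levelBase (i : ℕ) : Expr := hd i + .reg 1 * hd 4

def sortBody (i : ℕ) : Prog :=
  .seq (.assign 0 (posExpr (levelBase i) (.reg 0))) (.assign 1 (.reg 1 + .const 1))

def unsortBody (i : ℕ) : Prog :=
  .seq (.assign 1 (.reg 1 - .const 1)) (.assign 0 (posInvExpr (levelBase i) (.reg 0)))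

/-- Sort along the group of levels `i`, then undo the sorting along the group `j`. -/
def sweep (i j : ℕ) : Prog :=
  .seq (.loop (.op .lt (.reg 1) (hd 1)) (sortBody i)) (.loop (.reg 1) (unsortBody j))

/-- The state with the words `x` and `l` in the registers `0` and `1`. -/
def regState {w : ℕ} (m : BitVec w → BitVec w) (x l : ℕ) : State w where
  reg i := if i = 0 then BitVec.ofNat w x else if i = 1 then BitVec.ofNat w l else 0
  mem := m

theorem init_eq (w : ℕ) (E : List Bool) (x : ℕ) : init w E x = regState (packed w E) x 0 := by
  unfold init regState
  congr 1
  funext i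
  by_cases h : i = 0 <;> simp [Function.update, h]

section

variable {w : ℕ} {m : BitVec w → BitVec w} {x y l l' : ℕ} {e : Expr}

theorem ev_reg_zero : (Expr.reg 0).Ev (regState m x l) x := rfl

theorem ev_reg_one : (Expr.reg 1).Ev (regState m x l) l := rfl

theorem exec_assign_zero (h : e.Ev (regState m x l) y) :
    Exec (.assign 0 e) (regState m x l) (regState m y l) (e.cost + 1) := by
  convert Exec.assign 0 e (regState m x l) using 1
  rw [h]
  unfold regState
  congr 1
  funext i
  by_cases h : i = 0 <;> simp [Function.update, h]

theorem exec_assign_one (h : e.Ev (regState m x l) l') :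
    Exec (.assign 1 e) (regState m x l) (regState m x l') (e.cost + 1) := by
  convert Exec.assign 1 e (regState m x l) using 1
  rw [h]
  unfold regState
  congr 1
  funext i
  by_cases h : i = 0
  · simp [Function.update, h]
  · by_cases h1 : i = 1 <;> simp [Function.update, h, h1]

theorem ofNat_ne_zero {x : ℕ} (h0 : 0 < x) (hx : x < 2 ^ w) : BitVec.ofNat w x ≠ 0 := fun h => by
  have := congrArg BitVec.toNat h
  simp [Nat.mod_eq_of_lt hx] at this
  omega

end

def sortCost (i : ℕ) : ℕ :=
  (posExpr (levelBase i) (.reg 0)).cost + 1 + ((Expr.reg 1 + .const 1).cost + 1)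

def unsortCost (i : ℕ) : ℕ :=
  (Expr.reg 1 - .const 1).cost + 1 + ((posInvExpr (levelBase i) (.reg 0)).cost + 1)

section

variable {P : Layout} {m : BitVec P.w → BitVec P.w} {img : ℕ → ℕ} {S : ℕ → ℕ → ℕ} {i A : ℕ}

theorem ev_levelBase {s : State P.w} {T : ℕ → ℕ} {a l : ℕ} (h : Represents P s img T a)
    (hi : i < 28) (hA : P.header.getD i 0 = A) (hl : (Expr.reg 1).Ev s l) :
    (levelBase i).Ev s (A + l * P.stride) :=
  hA ▸ (h.ev_hd hi).add (hl.mul (h.ev_hd (i := 4) (by norm_num)))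

theorem exec_sort (hP : P.Valid) (hk : P.k < 2 ^ P.w) (hi : i < 28)
    (hA : P.header.getD i 0 = A)
    (h : ∀ l < P.k, ∀ x y, Represents P (regState m x y) img (S l) (A + l * P.stride))
    (hk1 : ∀ x y, (hd 1).Ev (regState m x y) P.k) {x : ℕ} (hx : x < P.N) :
    Exec (.loop (.op .lt (.reg 1) (hd 1)) (sortBody i)) (regState m x 0)
      (regState m (sortChain S P.N P.k x) P.k)
      (P.k * ((Expr.op .lt (.reg 1) (hd 1)).cost + 1 + sortCost i)
        + ((Expr.op .lt (.reg 1) (hd 1)).cost + 1)) := by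
  have hg : ∀ l ≤ P.k, (Expr.op .lt (.reg 1) (hd 1)).eval (regState m (sortChain S P.N l x) l)
      = BitVec.ofNat P.w (if l < P.k then 1 else 0) := fun l hl =>
    Ev.lt ev_reg_one (hk1 _ _) (hl.trans_lt hk) hk
  refine Exec.iterate (fun l => regState m (sortChain S P.N l x) l) ?_ ?_ ?_
  · intro l hl
    rw [hg l hl.le, if_pos hl]
    exact ofNat_ne_zero one_pos (by omega)
  · intro l hl
    have hr := h l hl (sortChain S P.N l x) l
    exact (exec_assign_zero (hr.ev_pos hP (ev_levelBase hr hi hA ev_reg_one) ev_reg_zero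
      (sortChain_lt hx l))).seq (exec_assign_one (ev_reg_one.add (ev_const 1)))
  · rw [hg P.k le_rfl, if_neg (lt_irrefl _)]
    rfl

/-- The levels are undone from the last to the first, hence the induction on the counter. The
counter is decremented before use, so value `l + 1` undoes level `l`. -/
theorem exec_unsort (hP : P.Valid) (hk : P.k < 2 ^ P.w) (hi : i < 28)
    (hA : P.header.getD i 0 = A)
    (h : ∀ l < P.k, ∀ x y, Represents P (regState m x y) img (S l) (A + l * P.stride))
    {l : ℕ} (hl : l ≤ P.k) {y : ℕ} (hy : y < P.N) :
    ∃ z < P.N, sortChain S P.N l z = y ∧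
      Exec (.loop (.reg 1) (unsortBody i)) (regState m y l) (regState m z 0)
        (l * ((Expr.reg 1).cost + 1 + unsortCost i) + ((Expr.reg 1).cost + 1)) := by
  induction l generalizing y with
  | zero =>
    refine ⟨y, hy, rfl, ?_⟩
    rw [zero_mul, zero_add]
    exact Exec.loop_false rfl
  | succ l ih =>
    have hr := h l hl y l
    obtain ⟨z', hz', hpos, hev⟩ :=
      hr.ev_posInv hP (ev_levelBase hr hi hA ev_reg_one) ev_reg_zero hy
    obtain ⟨z, hz, hc, hex⟩ := ih (by omega) hz'
    refine ⟨z, hz, by rw [sortChain, hc, hpos], ?_⟩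
    have h1 : Exec (unsortBody i) (regState m y (l + 1)) (regState m z' l) (unsortCost i) :=
      (exec_assign_one (l' := l) (ev_reg_one.sub (ev_const 1) (by omega))).seq
        (exec_assign_zero hev)
    have h2 := Exec.loop_true (e := .reg 1)
      (show (regState m y (l + 1)).reg 1 ≠ 0 from
        ofNat_ne_zero (Nat.succ_pos l) (by omega)) h1 hex
    convert h2 using 1
    ring

end

/-- A bound for the running time of `sweep` per level. -/
def sweepCost (i j : ℕ) : ℕ :=
  (Expr.op .lt (.reg 1) (hd 1)).cost + 1 + sortCost i + ((Expr.reg 1).cost + 1 + unsortCost j)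

theorem exec_sweep {P : Layout} {m : BitVec P.w → BitVec P.w} {img : ℕ → ℕ}
    {S U : ℕ → ℕ → ℕ} {i j A A' : ℕ}
    (hP : P.Valid) (hk : P.k < 2 ^ P.w) (hi : i < 28) (hj : j < 28)
    (hA : P.header.getD i 0 = A) (hA' : P.header.getD j 0 = A')
    (h : ∀ l < P.k, ∀ x y, Represents P (regState m x y) img (S l) (A + l * P.stride))
    (h' : ∀ l < P.k, ∀ x y, Represents P (regState m x y) img (U l) (A' + l * P.stride))
    (hk1 : ∀ x y, (hd 1).Ev (regState m x y) P.k) {x : ℕ} (hx : x < P.N) :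
    ∃ z < P.N, sortChain U P.N P.k z = sortChain S P.N P.k x ∧
      ∃ t ≤ sweepCost i j * (P.k + 1), Exec (sweep i j) (regState m x 0) (regState m z 0) t := by
  have h1 := exec_sort hP hk hi hA h hk1 hx
  obtain ⟨z, hz, hc, h2⟩ := exec_unsort hP hk hj hA' h' le_rfl (sortChain_lt (S := S) hx P.k)
  refine ⟨z, hz, hc, _, ?_, h1.seq h2⟩
  unfold sweepCost
  nlinarith [Nat.zero_le (sortCost i), Nat.zero_le (unsortCost j)]

/-- The query program: the identity if the first cell is `0`, a table if it is `1`, and otherwise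
a sweep over the levels. -/
def query (i j : ℕ) (e : Expr) : Prog :=
  .branch (hd 0) (.branch (hd 0 - .const 1) (sweep i j) (.assign 0 e)) .skip

/-- The programs for the permutation and for its inverse. -/
def applyProg : Prog := query 2 3 (.load (.const 2 + .reg 0))

def applyInvProg : Prog := query 3 2 (.load (.const 2 + hd 1 + .reg 0))

def queryCost : ℕ :=
  2 * ((hd 0).cost + 1 + ((hd 0 - .const 1).cost + 1)) + sweepCost 2 3 + sweepCost 3 2
    + (Expr.load (.const 2 + .reg 0)).cost + (Expr.load (.const 2 + hd 1 + .reg 0)).cost + 2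

/-- The empty bit string leaves all cells zero, and a zero first cell makes the program return its
argument. The identity thus costs no bits. -/
theorem answers_nil (w x : ℕ) (hx : x < 2 ^ w) (i j : ℕ) (e : Expr) :
    Answers (query i j e) w [] x x ((hd 0).cost + 1 + 1) := by
  refine ⟨_, Exec.branch_false ?_ (Exec.skip _), ?_⟩
  · simp only [hd, Expr.eval, init, packed]
    apply BitVec.eq_of_getLsbD_eq
    intro i hi
    simp [BitVec.getLsbD_ofFnLE]
  · simp [init, Nat.mod_eq_of_lt hx]

/-- One memory serves both programs: they differ only in which group of `k` levels is sorted and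
which is undone. -/
theorem answers_layout {P : Layout} (hP : P.Valid) {S : ℕ → ℕ → ℕ}
    (hS : ∀ l < 2 * P.k, ∀ y < P.N, S l y < P.d) {x : ℕ} (hx : x < P.N) :
    (∃ z < P.N, sortChain (fun l => S (P.k + l)) P.N P.k z = sortChain S P.N P.k x ∧
      ∃ t ≤ queryCost * (P.k + 1),
        Answers applyProg P.w (bits P.w P.total (P.image S)) x z t) ∧
    (∃ z < P.N, sortChain S P.N P.k z = sortChain (fun l => S (P.k + l)) P.N P.k x ∧
      ∃ t ≤ queryCost * (P.k + 1),
        Answers applyInvProg P.w (bits P.w P.total (P.image S)) x z t) := by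
  set m := packed P.w (bits P.w P.total (P.image S)) with hm
  have hs : ∀ x y, (regState m x y).Holds (P.image S) P.total :=
    fun x y a ha => packed_bits hP.total_le ha
  have hA : ∀ l < P.k, ∀ x y, Represents P (regState m x y) (P.image S) (S l)
      (regionAddr P.sizes 4 + l * P.stride) := fun l hl x y =>
    Layout.represents (hs x y) hS (by omega)
  have hB : ∀ l < P.k, ∀ x y, Represents P (regState m x y) (P.image S) (S (P.k + l))
      (regionAddr P.sizes 4 + P.k * P.stride + l * P.stride) := fun l hl x y => by
    rw [add_assoc, ← add_mul]
    exact Layout.represents (hs x y) hS (by omega)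
  -- Each of the `2 * k` levels occupies at least one cell, so `k` is a word.
  have htot : 28 + 2 * P.k ≤ P.total := by
    have h1 : 1 ≤ P.stride := by
      have := regionAddr_add_lt (sz := P.levelSizes) (j := 0) (a := 0) (Nat.succ_pos _)
      exact lt_of_le_of_lt (Nat.zero_le _) this
    have h2 : 2 * P.k ≤ 2 * P.k * P.stride := Nat.le_mul_of_pos_right _ h1
    simp only [Layout.total, Layout.sizes, List.sum_cons]
    omega
  have hk : P.k < 2 ^ P.w := lt_of_lt_of_le (by omega) hP.total_le
  have hhd : ∀ i < 28, ∀ x y, (hd i).Ev (regState m x y) (P.header.getD i 0) := by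
    intro i hi x y
    refine ((ev_const i).load (hs x y) (by omega)).congr ?_
    have := cat_regionAddr (sz := P.sizes) (j := 0) (P.region S) (a := i) hi
    rw [regionAddr, List.take_zero, List.sum_nil, zero_add] at this
    exact this
  have hw : 2 < 2 ^ P.w := lt_of_lt_of_le (by omega) hP.total_le
  have h0 : (hd 0).eval (init P.w (bits P.w P.total (P.image S)) x) ≠ 0 := by
    rw [init_eq, ← hm]
    have := hhd 0 (by norm_num) x 0
    unfold Expr.Ev at this
    rw [this]
    exact ofNat_ne_zero (x := 2) (by norm_num) hw
  have h1 : (hd 0 - .const 1 : Expr).eval (init P.w (bits P.w P.total (P.image S)) x) ≠ 0 := by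
    rw [init_eq, ← hm]
    have := (hhd 0 (by norm_num) x 0).sub (ev_const 1) (show 1 ≤ 2 by norm_num)
    unfold Expr.Ev at this
    rw [this]
    exact ofNat_ne_zero (x := 1) (by norm_num) (by omega)
  constructor
  · obtain ⟨z, hz, hc, t, ht, hex⟩ := exec_sweep (i := 2) (j := 3) hP hk (by norm_num)
      (by norm_num) rfl rfl hA hB (hhd 1 (by norm_num)) hx
    rw [hm, ← init_eq] at hex
    refine ⟨z, hz, hc, _, ?_, regState m z 0, .branch_true h0 (.branch_true h1 hex), ?_⟩
    · unfold queryCost; nlinarith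
    · simp [regState, Nat.mod_eq_of_lt (hz.trans hP.N_lt)]
  · obtain ⟨z, hz, hc, t, ht, hex⟩ := exec_sweep (i := 3) (j := 2) hP hk (by norm_num)
      (by norm_num) rfl rfl hB hA (hhd 1 (by norm_num)) hx
    rw [hm, ← init_eq] at hex
    refine ⟨z, hz, hc, _, ?_, regState m z 0, .branch_true h0 (.branch_true h1 hex), ?_⟩
    · unfold queryCost; nlinarith
    · simp [regState, Nat.mod_eq_of_lt (hz.trans hP.N_lt)]

/-- The contents of the memory that holds tables of `f` and `g` with `n` entries. -/
def tableImage (n : ℕ) (f g : ℕ → ℕ) (a : ℕ) : ℕ :=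
  if a = 0 then 1 else if a = 1 then n else if a < 2 + n then f (a - 2) else g (a - 2 - n)

theorem answers_table {w n : ℕ} (hn : 2 + 2 * n ≤ 2 ^ w) {f g : ℕ → ℕ} {x : ℕ} (hx : x < n)
    (hf : f x < n) (hg : g x < n) :
    (∃ t ≤ queryCost, Answers applyProg w (bits w (2 + 2 * n) (tableImage n f g)) x (f x) t) ∧
    (∃ t ≤ queryCost,
      Answers applyInvProg w (bits w (2 + 2 * n) (tableImage n f g)) x (g x) t) := by
  set m := packed w (bits w (2 + 2 * n) (tableImage n f g)) with hm
  have hs : (regState m x 0).Holds (tableImage n f g) (2 + 2 * n) :=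
    fun a ha => packed_bits hn ha
  have hhd : (hd 0).Ev (regState m x 0) 1 := (ev_const 0).load hs (by omega)
  have h0 : (hd 0).eval (init w (bits w (2 + 2 * n) (tableImage n f g)) x) ≠ 0 := by
    rw [init_eq, ← hm]
    unfold Expr.Ev at hhd
    rw [hhd]
    exact ofNat_ne_zero (x := 1) (by norm_num) (by omega)
  have h1 : (hd 0 - .const 1 : Expr).eval (init w (bits w (2 + 2 * n) (tableImage n f g)) x)
      = 0 := by
    rw [init_eq, ← hm]
    have := hhd.sub (ev_const 1) le_rfl
    exact this
  constructor
  · have h2 : (Expr.load (.const 2 + .reg 0)).Ev (regState m x 0) (f x) :=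
      (((ev_const 2).add ev_reg_zero).load hs (by omega)).congr (by
        simp [tableImage, hx]
        omega)
    have hex := exec_assign_zero h2
    rw [hm, ← init_eq] at hex
    refine ⟨_, ?_, regState m (f x) 0, .branch_true h0 (.branch_false h1 hex), ?_⟩
    · unfold queryCost; omega
    · simp only [regState, if_true, BitVec.toNat_ofNat]
      exact Nat.mod_eq_of_lt (by omega)
  · have h3 : (hd 1).Ev (regState m x 0) n := (ev_const 1).load hs (by omega)
    have h2 : (Expr.load (.const 2 + hd 1 + .reg 0)).Ev (regState m x 0) (g x) :=
      ((((ev_const 2).add h3).add ev_reg_zero).load hs (by omega)).congr (by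
        rw [tableImage, if_neg (by omega), if_neg (by omega), if_neg (by omega)]
        congr 1
        omega)
    have hex := exec_assign_zero h2
    rw [hm, ← init_eq] at hex
    refine ⟨_, ?_, regState m (g x) 0, .branch_true h0 (.branch_false h1 hex), ?_⟩
    · unfold queryCost; omega
    · simp only [regState, if_true, BitVec.toNat_ofNat]
      exact Nat.mod_eq_of_lt (by omega)

end WordRAM

/-! ### Radix sort -/

namespace StableSort

theorem pos_inj {S : ℕ → ℕ} {N x y : ℕ} (hx : x < N) (hy : y < N)
    (h : pos S N x = pos S N y) : x = y := by
  by_contra hne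
  have h1 := pos_lt_iff (S := S) hx hy
  have h2 := pos_lt_iff (S := S) hy hx
  omega

/-- Stable sorting as a permutation. -/
noncomputable def posPerm (S : ℕ → ℕ) (N : ℕ) : Equiv.Perm (Fin N) :=
  Equiv.ofBijective (fun x => ⟨pos S N x, pos_lt x.2⟩)
    (Finite.injective_iff_bijective.1 fun x y h =>
      Fin.ext (pos_inj x.2 y.2 (congrArg Fin.val h)))

theorem posPerm_val (S : ℕ → ℕ) {N : ℕ} (x : Fin N) : (posPerm S N x : ℕ) = pos S N x := rfl

/-- The permutation `f * g⁻¹` is strictly monotone, and a finite chain has no order automorphism but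
the identity. -/
theorem perm_eq_of_lt_iff {N : ℕ} {f g : Equiv.Perm (Fin N)}
    (h : ∀ x y, f x < f y ↔ g x < g y) : f = g := by
  have hmono : StrictMono (f * g⁻¹ : Equiv.Perm (Fin N)) := fun x y hxy => by
    rw [Equiv.Perm.mul_apply, Equiv.Perm.mul_apply, h]
    simpa using hxy
  have h1 := Subsingleton.elim (hmono.orderIsoOfSurjective _ (Equiv.surjective _))
    (OrderIso.refl (Fin N))
  have h2 : f * g⁻¹ = 1 := Equiv.ext fun x => DFunLike.congr_fun h1 x
  exact mul_inv_eq_one.1 h2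

theorem lt_iff_div_mod {D a b : ℕ} :
    a < b ↔ a / D < b / D ∨ a / D = b / D ∧ a % D < b % D := by
  have ha := Nat.div_add_mod a D
  have hb := Nat.div_add_mod b D
  constructor
  · intro h
    rcases (Nat.div_le_div_right (c := D) h.le).lt_or_eq with h1 | h1
    · exact .inl h1
    · rw [h1] at ha
      exact .inr ⟨h1, by omega⟩
  · rintro (h | ⟨h1, h2⟩)
    · by_contra hc
      exact absurd (Nat.div_le_div_right (c := D) (not_lt.1 hc)) (not_le.2 h)
    · rw [h1] at ha
      omega

theorem sortChain_congr {S U : ℕ → ℕ → ℕ} {N k : ℕ} (h : ∀ l < k, S l = U l) (x : ℕ) :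
    WordRAM.sortChain S N k x = WordRAM.sortChain U N k x := by
  induction k with
  | zero => rfl
  | succ k ih =>
    rw [WordRAM.sortChain, WordRAM.sortChain, ih fun l hl => h l (by omega), h k (by omega)]

/-- Radix sort: stable sorting by a string of `k`-digit numbers is a composition of `k` stable
sortings by single digits. -/
theorem exists_sortChain {d N : ℕ} (k : ℕ) (S : ℕ → ℕ) (hS : ∀ y < N, S y < d ^ k) :
    ∃ L : ℕ → ℕ → ℕ, (∀ l < k, ∀ y < N, L l y < d) ∧
      ∀ x < N, WordRAM.sortChain L N k x = pos S N x := by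
  induction k generalizing S with
  | zero =>
    have h0 : ∀ y < N, S y = 0 := fun y hy => by simpa using hS y hy
    refine ⟨fun _ _ => 0, by simp, fun x hx => ?_⟩
    have h1 : posPerm S N = 1 := perm_eq_of_lt_iff fun x y => by
      rw [Fin.lt_def, posPerm_val, posPerm_val, pos_lt_iff x.2 y.2, h0 x x.2, h0 y y.2]
      simp
    have := posPerm_val S ⟨x, hx⟩
    rw [h1] at this
    exact this
  | succ k ih =>
    rcases Nat.eq_zero_or_pos d with rfl | hd
    · refine ⟨fun _ _ => 0, fun l _ y hy => ?_, fun x hx => ?_⟩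
      · simpa using hS y hy
      · simpa using hS x hx
    -- The low `k` digits are sorted first; stability preserves their order among equal top digits.
    obtain ⟨L, hL, hc⟩ := ih (fun y => S y % d ^ k) fun y _ => Nat.mod_lt _ (by positivity)
    set f := posPerm (fun y => S y % d ^ k) N with hf
    -- The top digits are listed in the order left by the earlier sortings, hence the transport
    -- along `f`.
    set T : ℕ → ℕ := fun q => if h : q < N then S (f.symm ⟨q, h⟩) / d ^ k else 0 with hT
    have hTf : ∀ x : Fin N, T (f x) = S x / d ^ k := fun x => by simp [hT]
    refine ⟨fun l => if l < k then L l else T, fun l hl y hy => ?_, fun x hx => ?_⟩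
    · by_cases h : l < k
      · simpa [h] using hL l h y hy
      · simp only [h, if_false, hT, hy, dif_pos]
        apply Nat.div_lt_of_lt_mul
        rw [← pow_succ]
        exact hS _ (Fin.is_lt _)
    · rw [WordRAM.sortChain, sortChain_congr (U := L) (fun l hl => by simp [hl]), hc x hx]
      simp only [lt_irrefl, if_false]
      have h1 : posPerm T N * f = posPerm S N := perm_eq_of_lt_iff fun x y => by
        rw [Equiv.Perm.mul_apply, Equiv.Perm.mul_apply, Fin.lt_def, Fin.lt_def,
          posPerm_val T (f x), posPerm_val T (f y), posPerm_val S x, posPerm_val S y,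
          pos_lt_iff (f x).2 (f y).2, pos_lt_iff x.2 y.2, hTf, hTf, hf,
          posPerm_val _ x, posPerm_val _ y, pos_lt_iff x.2 y.2,
          lt_iff_div_mod (D := d ^ k) (a := S x) (b := S y)]
        have ha := Nat.div_add_mod (S x) (d ^ k)
        have hb := Nat.div_add_mod (S y) (d ^ k)
        constructor
        · rintro (h | ⟨h, h2 | ⟨h2, h3⟩⟩)
          · exact .inl (.inl h)
          · exact .inl (.inr ⟨h, h2⟩)
          · exact .inr ⟨by rw [← ha, ← hb, h, h2], h3⟩
        · rintro ((h | h) | ⟨h, h3⟩)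
          · exact .inl h
          · exact .inr ⟨h.1, .inl h.2⟩
          · exact .inr ⟨by rw [h], .inr ⟨by rw [h], h3⟩⟩
      exact congrArg Fin.val (Equiv.ext_iff.1 h1 ⟨x, hx⟩)

end StableSort

/-! ### Covered permutations as pairs of stable sortings -/

namespace IsCoveredBySUS

open StableSort

variable {n σ : ℕ} {π : Equiv.Perm (Fin n)}

theorem le (h : IsCoveredBySUS π σ) : σ ≤ n := by
  obtain ⟨D, hD, -⟩ := h
  rw [← hD]
  simpa using D.card_parts_le_card

theorem pos (h : IsCoveredBySUS π σ) (hn : 0 < n) : 0 < σ := by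
  obtain ⟨D, hD, -⟩ := h
  rw [← hD]
  exact Finset.card_pos.2 ⟨_, D.part_mem.2 (Finset.mem_univ (⟨0, hn⟩ : Fin n))⟩

theorem exists_labels (h : IsCoveredBySUS π σ) :
    ∃ c : Fin n → Fin σ, ∀ i j, c i = c j → i < j → π i < π j := by
  obtain ⟨D, hD, hmono⟩ := h
  refine ⟨fun i => D.parts.equivFinOfCardEq hD ⟨D.part i, D.part_mem.2 (Finset.mem_univ i)⟩,
    fun i j hij hlt => ?_⟩
  have h1 : D.part i = D.part j :=
    congrArg Subtype.val ((D.parts.equivFinOfCardEq hD).injective hij)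
  refine hmono _ (D.part_mem.2 (Finset.mem_univ i)) ?_ ?_ hlt
  · exact D.mem_part (Finset.mem_univ i)
  · rw [h1]
    exact D.mem_part (Finset.mem_univ j)

theorem eq_one (h : IsCoveredBySUS π 1) : π = 1 := by
  obtain ⟨c, hc⟩ := h.exists_labels
  refine perm_eq_of_lt_iff fun x y => ?_
  rw [Equiv.Perm.one_apply, Equiv.Perm.one_apply]
  have hm : StrictMono π := fun x y hxy => hc x y (Subsingleton.elim _ _) hxy
  exact hm.lt_iff_lt

/-- A covered permutation is a stable sorting followed by an inverse stable sorting. -/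
theorem exists_pos_eq (h : IsCoveredBySUS π σ) (hn : 0 < n) {N : ℕ} (hN : n ≤ N) :
    ∃ S U : ℕ → ℕ, (∀ y, S y < σ) ∧ (∀ y, U y < σ) ∧
      ∀ i : Fin n, StableSort.pos U N (π i) = StableSort.pos S N i := by
  have hσ := h.pos hn
  obtain ⟨c, hc⟩ := h.exists_labels
  -- `π` is extended by the identity to the positions that pad the string to whole blocks.
  let ρ : Fin N → Fin N := fun x =>
    if h : (x : ℕ) < n then ⟨π ⟨x, h⟩, (Fin.is_lt _).trans_le hN⟩ else x
  have hρ1 : ∀ (x : Fin N) (h : (x : ℕ) < n), (ρ x : ℕ) = π ⟨x, h⟩ := fun x h => by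
    simp [ρ, h]
  have hρ2 : ∀ x : Fin N, n ≤ (x : ℕ) → ρ x = x := fun x h => by simp [ρ, not_lt.2 h]
  have hinj : Function.Injective ρ := fun x y hxy => by
    have hv := congrArg Fin.val hxy
    rcases lt_or_ge (x : ℕ) n with hx | hx <;> rcases lt_or_ge (y : ℕ) n with hy | hy
    · rw [hρ1 x hx, hρ1 y hy] at hv
      have := congrArg Fin.val (π.injective (Fin.ext hv))
      exact Fin.ext this
    · rw [hρ1 x hx, hρ2 y hy] at hv
      have := (π ⟨x, hx⟩).2
      omega
    · rw [hρ2 x hx, hρ1 y hy] at hv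
      have := (π ⟨y, hy⟩).2
      omega
    · rwa [hρ2 x hx, hρ2 y hy] at hxy
  let ρ' : Equiv.Perm (Fin N) := Equiv.ofBijective ρ (Finite.injective_iff_bijective.1 hinj)
  -- Padding gets label `0`. Class `0` stays increasing: the padding is fixed and lies above all
  -- indices and values of `π`.
  let S : ℕ → ℕ := fun y => if h : y < n then c ⟨y, h⟩ else 0
  let U : ℕ → ℕ := fun y => if h : y < n then c (π.symm ⟨y, h⟩) else 0
  have hS : ∀ y, S y < σ := fun y => by
    by_cases h : y < n <;> simp [S, h, hσ]
  have hU : ∀ y, U y < σ := fun y => by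
    by_cases h : y < n <;> simp [U, h, hσ]
  have hUρ : ∀ x : Fin N, U (ρ x) = S x := fun x => by
    rcases lt_or_ge (x : ℕ) n with hx | hx
    · rw [hρ1 x hx]
      simp [U, S, hx]
    · rw [hρ2 x hx]
      simp [U, S, not_lt.2 hx]
  have hmono : ∀ x y : Fin N, S x = S y → x < y → ρ x < ρ y := fun x y hxy hlt => by
    rcases lt_or_ge (y : ℕ) n with hy | hy
    · have hx : (x : ℕ) < n := lt_trans hlt hy
      rw [Fin.lt_def, hρ1 x hx, hρ1 y hy]
      refine hc _ _ (Fin.ext ?_) hlt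
      simpa [S, hx, hy] using hxy
    · rw [Fin.lt_def, hρ2 y hy]
      rcases lt_or_ge (x : ℕ) n with hx | hx
      · rw [hρ1 x hx]
        exact (Fin.is_lt _).trans_le hy
      · rwa [hρ2 x hx]
  -- `ρ` preserves labels and increases within each class, so both sides order positions by label
  -- and then by index.
  have hkey : posPerm U N * ρ' = posPerm S N := perm_eq_of_lt_iff fun x y => by
    rw [Equiv.Perm.mul_apply, Equiv.Perm.mul_apply, Fin.lt_def, Fin.lt_def, posPerm_val,
      posPerm_val, posPerm_val, posPerm_val, pos_lt_iff (ρ' x).2 (ρ' y).2, pos_lt_iff x.2 y.2]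
    change U (ρ x) < U (ρ y) ∨ U (ρ x) = U (ρ y) ∧ ρ x < ρ y ↔ _ ∨ _ ∧ x < y
    rw [hUρ, hUρ]
    refine or_congr_right (and_congr_right fun hxy => ⟨fun hlt => ?_, hmono x y hxy⟩)
    rcases lt_trichotomy x y with h1 | h1 | h1
    · exact h1
    · rw [h1] at hlt
      exact absurd hlt (lt_irrefl _)
    · exact absurd (hlt.trans (hmono y x hxy.symm h1)) (lt_irrefl _)
  refine ⟨S, U, hS, hU, fun i => ?_⟩
  have h1 := congrArg Fin.val (Equiv.ext_iff.1 hkey ⟨i, i.2.trans_le hN⟩)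
  rw [Equiv.Perm.mul_apply, posPerm_val, posPerm_val] at h1
  change StableSort.pos U N (ρ ⟨i, i.2.trans_le hN⟩ : ℕ) = _ at h1
  rwa [hρ1 _ i.2] at h1

end IsCoveredBySUS

/-! ### Choice of parameters and space bounds -/

namespace WordRAM

/-- The parameters used for `n` symbols less than `d` and words of `w` bits, where `s` is the
binary length of `w`. -/
def mainLayout (n w s d k : ℕ) : Layout where
  w := w
  K := n / (w ^ 4 * s ^ 4) + 1
  G := w ^ 4
  g := s ^ 4
  d := d
  u₁ := w ^ 2
  u₂ := s ^ 2
  b := Nat.clog 2 (d ^ s ^ 4)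
  f := 8 * s
  k := k

/-- Space accounting for packed arrays: if `p` fields share a cell of `w ≤ p * m` bits, then each
field is charged `m` bits. -/
theorem div_mul_le_of_le_mul {X p w m : ℕ} (h : w ≤ p * m) : X / p * w ≤ X * m := by
  calc X / p * w ≤ X / p * (p * m) := Nat.mul_le_mul_left _ h
    _ = X / p * p * m := by ring
    _ ≤ X * m := Nat.mul_le_mul_right _ (Nat.div_mul_le_self _ _)

/-- The fewer than `b` leftover bits of a cell are spread over at least `b` fields, one bit each.
For directory fields the cruder factor two of `le_div_mul_two` is affordable. -/
theorem le_div_mul_succ {w b : ℕ} (hb : 0 < b) (h : b * b ≤ w) : w ≤ w / b * (b + 1) := by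
  have h1 : b ≤ w / b := (Nat.le_div_iff_mul_le hb).2 h
  have h2 := Nat.div_add_mod' w b
  have h3 := Nat.mod_lt w hb
  rw [mul_add, mul_one]
  omega

theorem le_div_mul_two {w f : ℕ} (hf : 0 < f) (h : f ≤ w) : w ≤ w / f * (2 * f) := by
  have h1 : 1 ≤ w / f := (Nat.le_div_iff_mul_le hf).2 (by omega)
  have h2 := Nat.div_add_mod' w f
  have h3 := Nat.mod_lt w hf
  nlinarith

variable {n w s d k : ℕ}

/-- The right side charges bits to chunks of `s ^ 4` symbols, so the redundancy is `O(d / s)` bits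
per symbol. Global directories use full words but are sparse by powers of `w`; local ones have `O(d
* s ^ 2)` fields of `8 * s` bits per chunk. -/
theorem stride_mul_le (hs : 0 < s) (hsw : 8 * s ≤ w) (hd : 0 < d)
    (hb0 : 0 < Nat.clog 2 (d ^ s ^ 4))
    (hb : Nat.clog 2 (d ^ s ^ 4) * Nat.clog 2 (d ^ s ^ 4) ≤ w) :
    (mainLayout n w s d k).stride * w ≤ (n / (w ^ 4 * s ^ 4) + 1) * w ^ 4 *
      (Nat.clog 2 (d ^ s ^ 4) + 102 * d * s ^ 3) := by
  simp only [Layout.stride, Layout.levelSizes, Layout.N, Layout.B, mainLayout, List.sum_cons,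
    List.sum_nil]
  generalize hK : n / (w ^ 4 * s ^ 4) + 1 = K
  generalize Nat.clog 2 (d ^ s ^ 4) = b at *
  have hK1 : 1 ≤ K := hK ▸ Nat.succ_pos _
  have hw : 8 ≤ w := by omega
  have hN : K * (w ^ 4 * s ^ 4) / w ^ 2 = K * w ^ 2 * s ^ 4 := by
    rw [show K * (w ^ 4 * s ^ 4) = K * w ^ 2 * s ^ 4 * w ^ 2 by ring]
    exact Nat.mul_div_cancel _ (by positivity)
  have hB : w ^ 4 * s ^ 4 / s ^ 2 = w ^ 4 * s ^ 2 := by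
    rw [show w ^ 4 * s ^ 4 = w ^ 4 * s ^ 2 * s ^ 2 by ring]
    exact Nat.mul_div_cancel _ (by positivity)
  rw [hN, hB]
  have t0 := div_mul_le_of_le_mul (X := K * w ^ 4) (le_div_mul_succ hb0 hb)
  have hf := le_div_mul_two (f := 8 * s) (by omega) hsw
  have t4 := div_mul_le_of_le_mul (X := d * K * (w ^ 4 + 1)) hf
  have t5 := div_mul_le_of_le_mul (X := d * K * (w ^ 4 * s ^ 2 + 1)) hf
  have t6 := div_mul_le_of_le_mul (X := d * K * w ^ 4 * (s ^ 2 + 1)) hf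
  generalize K * w ^ 4 / (w / b) = x0 at *
  generalize d * K * (w ^ 4 + 1) / (w / (8 * s)) = x4 at *
  generalize d * K * (w ^ 4 * s ^ 2 + 1) / (w / (8 * s)) = x5 at *
  generalize d * K * w ^ 4 * (s ^ 2 + 1) / (w / (8 * s)) = x6 at *
  have hs1 : 1 ≤ s := hs
  have hs2 : 1 ≤ s ^ 2 := Nat.one_le_pow _ _ hs
  have hs3 : 1 ≤ s ^ 3 := Nat.one_le_pow _ _ hs
  have hw4 : 1 ≤ w ^ 4 := Nat.one_le_pow _ _ (by omega)
  -- In units of `K * w ^ 4 * (d * s ^ 3)` the bounds `c1` to `c8` cost 1, 1, 1, 2, 32, 32, 32 and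
  -- 1, in total 102.
  have c1 : 7 * w ≤ K * w ^ 4 * (d * s ^ 3) := by
    calc 7 * w ≤ w ^ 3 * w := Nat.mul_le_mul_right _ (by
          calc 7 ≤ 8 ^ 3 := by norm_num
            _ ≤ w ^ 3 := Nat.pow_le_pow_left hw 3)
      _ = 1 * w ^ 4 * (1 * 1) := by ring
      _ ≤ K * w ^ 4 * (d * s ^ 3) := by gcongr; exact hd
  have c2 : d * K * w ≤ K * w ^ 4 * (d * s ^ 3) := by
    calc d * K * w = K * w ^ 1 * (d * 1) := by ring
      _ ≤ K * w ^ 4 * (d * s ^ 3) := by gcongr <;> omega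
  have c3 : K * w ^ 2 * s ^ 4 * w ≤ K * w ^ 4 * (d * s ^ 3) := by
    calc K * w ^ 2 * s ^ 4 * w = K * w ^ 3 * s * (1 * s ^ 3) := by ring
      _ ≤ K * w ^ 3 * w * (d * s ^ 3) := by gcongr <;> omega
      _ = _ := by ring
  have c4 : d * K * (w ^ 2 + 1) * w ≤ K * w ^ 4 * (d * s ^ 3) * 2 := by
    calc d * K * (w ^ 2 + 1) * w ≤ d * K * (w ^ 2 + w ^ 2) * w ^ 2 := by
          gcongr
          · exact Nat.one_le_pow _ _ (by omega)
          · exact Nat.le_self_pow (by norm_num) _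
      _ = K * w ^ 4 * (d * 1) * 2 := by ring
      _ ≤ _ := by gcongr
  have c5 : d * K * (w ^ 4 + 1) * (2 * (8 * s)) ≤ K * w ^ 4 * (d * s ^ 3) * 32 := by
    calc d * K * (w ^ 4 + 1) * (2 * (8 * s)) ≤ d * K * (w ^ 4 + w ^ 4) * (2 * (8 * s ^ 3)) := by
          gcongr
          exact Nat.le_self_pow (by norm_num) _
      _ = _ := by ring
  have c6 : d * K * (w ^ 4 * s ^ 2 + 1) * (2 * (8 * s)) ≤ K * w ^ 4 * (d * s ^ 3) * 32 := by
    calc d * K * (w ^ 4 * s ^ 2 + 1) * (2 * (8 * s))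
        ≤ d * K * (w ^ 4 * s ^ 2 + w ^ 4 * s ^ 2) * (2 * (8 * s)) := by
          gcongr
          exact Nat.mul_pos hw4 hs2
      _ = _ := by ring
  have c7 : d * K * w ^ 4 * (s ^ 2 + 1) * (2 * (8 * s)) ≤ K * w ^ 4 * (d * s ^ 3) * 32 := by
    calc d * K * w ^ 4 * (s ^ 2 + 1) * (2 * (8 * s))
        ≤ d * K * w ^ 4 * (s ^ 2 + s ^ 2) * (2 * (8 * s)) := by gcongr
      _ = _ := by ring
  have c8 : K * w ^ 4 ≤ K * w ^ 4 * (d * s ^ 3) := Nat.le_mul_of_pos_right _ (by positivity)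
  have expand : K * w ^ 4 * (b + 102 * d * s ^ 3) = K * w ^ 4 * b
      + K * w ^ 4 * (d * s ^ 3) * 102 := by ring
  rw [expand]
  rw [mul_add, mul_one] at t0
  have lhs : (x0 + 1 + (d * K + 1 + (K * w ^ 2 * s ^ 4 + 1 + (d * K * (w ^ 2 + 1)
      + (x4 + 1 + (x5 + 1 + (x6 + 1 + 0))))))) * w = x0 * w + d * K * w + K * w ^ 2 * s ^ 4 * w
      + d * K * (w ^ 2 + 1) * w + x4 * w + x5 * w + x6 * w + 6 * w := by ring
  rw [lhs]
  omega

variable {n w s c d k : ℕ}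

/-- The relations between the parameters that hold for large `n`. -/
structure Regime (n w s c d : ℕ) : Prop where
  four_le : 4 ≤ s
  d_le : d ≤ s
  two_le : 2 ≤ d
  c_le : c ≤ s
  pow_le : s ^ 10 ≤ w
  lt_pow : w < 2 ^ s
  log_le : Nat.log 2 n + 4 ≤ w
  le_log : w ≤ c * (Nat.log 2 n + 1)
  pos : 0 < n

namespace Regime

/-- From `s ^ 10 ≤ w` and `w ≤ s * (lg n + 1)` the logarithm of `n` is of order at least `s ^ 9`.
The exponent `s ^ 6` already dwarfs the decoding tables. -/
theorem two_pow_le (h : Regime n w s c d) : 2 ^ s ^ 6 ≤ n := by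
  refine le_trans (Nat.pow_le_pow_right (by norm_num) ?_) (Nat.pow_log_le_self 2 h.pos.ne')
  have h4 := h.four_le
  have h1 : s * (s ^ 6 + 1) ≤ s ^ 10 := by
    calc s * (s ^ 6 + 1) ≤ s * (s ^ 6 + s ^ 6) := by
          gcongr
          exact Nat.one_le_pow _ _ (by omega)
      _ = s ^ 6 * s * 2 := by ring
      _ ≤ s ^ 6 * s * s ^ 3 := by
          gcongr
          exact le_trans (by omega) (Nat.le_self_pow (n := 3) (by norm_num) s)
      _ = s ^ 10 := by ring
  have h2 : s * (s ^ 6 + 1) ≤ s * (Nat.log 2 n + 1) :=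
    (h1.trans h.pow_le).trans (h.le_log.trans (Nat.mul_le_mul_right _ h.c_le))
  have h3 := Nat.le_of_mul_le_mul_left h2 (by omega)
  omega

theorem clog_le (s d : ℕ) : Nat.clog 2 (d ^ s ^ 4) ≤ d * s ^ 4 := by
  apply Nat.clog_le_of_le_pow
  rw [pow_mul]
  exact Nat.pow_le_pow_left Nat.lt_two_pow_self.le _

theorem clog_pos (h : Regime n w s c d) : 0 < Nat.clog 2 (d ^ s ^ 4) := by
  have h4 := h.four_le
  have h2 := h.two_le
  apply Nat.clog_pos (by norm_num)
  exact h2.trans (Nat.le_self_pow (by positivity) _)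

/-- Here the exponent in `pow_le` is used: a chunk code has at most `s ^ 5` bits, so that packing
loses only one bit per code. -/
theorem clog_sq_le (h : Regime n w s c d) : Nat.clog 2 (d ^ s ^ 4) * Nat.clog 2 (d ^ s ^ 4) ≤ w := by
  have h1 : Nat.clog 2 (d ^ s ^ 4) ≤ s * s ^ 4 :=
    (clog_le s d).trans (Nat.mul_le_mul_right _ h.d_le)
  calc _ ≤ s * s ^ 4 * (s * s ^ 4) := Nat.mul_le_mul h1 h1
    _ = s ^ 10 := by ring
    _ ≤ w := h.pow_le

theorem eight_mul_lt (h : Regime n w s c d) : 8 * s < w := by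
  have h4 := h.four_le
  calc 8 * s < 4 ^ 9 * s := by omega
    _ ≤ s ^ 9 * s := by gcongr
    _ = s ^ 10 := by ring
    _ ≤ w := h.pow_le

/-- Padding adds at most one block, which is thus at most `n / s` symbols. -/
theorem block_mul_le (h : Regime n w s c d) : s * (w ^ 4 * s ^ 4) ≤ n := by
  have h4 := h.four_le
  have hs : s ≤ 2 ^ s := Nat.lt_two_pow_self.le
  calc s * (w ^ 4 * s ^ 4) ≤ 2 ^ s * ((2 ^ s) ^ 4 * (2 ^ s) ^ 4) := by
        gcongr
        exact h.lt_pow.le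
    _ = 2 ^ (s * 9) := by ring
    _ ≤ 2 ^ s ^ 6 := by
        apply Nat.pow_le_pow_right (by norm_num)
        calc s * 9 ≤ s * 4 ^ 5 := by omega
          _ ≤ s * s ^ 5 := by gcongr
          _ = s ^ 6 := by ring
    _ ≤ n := h.two_pow_le

/-- The tables have `2 ^ s ^ 5` entries up to factors `2 ^ O(s)`, negligible against `2 ^ s ^ 6 ≤
n`. -/
theorem tables_mul_le (h : Regime n w s c d) : s * ((28 + 2 ^ Nat.clog 2 (d ^ s ^ 4) * s ^ 4
    + 2 ^ Nat.clog 2 (d ^ s ^ 4) * s ^ 4 + 2 ^ Nat.clog 2 (d ^ s ^ 4) * d * s ^ 4) * w) ≤ n := by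
  have h4 := h.four_le
  have hs : s ≤ 2 ^ s := Nat.lt_two_pow_self.le
  have hb : 2 ^ Nat.clog 2 (d ^ s ^ 4) ≤ 2 ^ s ^ 5 := by
    apply Nat.pow_le_pow_right (by norm_num)
    calc _ ≤ s * s ^ 4 := (clog_le s d).trans (Nat.mul_le_mul_right _ h.d_le)
      _ = s ^ 5 := by ring
  have hd := h.d_le
  have hx : 1 ≤ 2 ^ s ^ 5 := Nat.one_le_two_pow
  have hs1 : 1 ≤ s := by omega
  have hs4 : 1 ≤ s ^ 4 := Nat.one_le_pow _ _ (by omega)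
  calc _ ≤ s * ((28 * (2 ^ s ^ 5 * s * s ^ 4) + 2 ^ s ^ 5 * s * s ^ 4
        + 2 ^ s ^ 5 * s * s ^ 4 + 2 ^ s ^ 5 * s * s ^ 4) * 2 ^ s) := by
        have e1 : 1 ≤ 2 ^ s ^ 5 * s * s ^ 4 := Nat.mul_pos (Nat.mul_pos hx hs1) hs4
        have e2 : 2 ^ Nat.clog 2 (d ^ s ^ 4) * s ^ 4 ≤ 2 ^ s ^ 5 * s * s ^ 4 := by
          gcongr
          exact hb.trans (Nat.le_mul_of_pos_right _ hs1)
        have e3 : 2 ^ Nat.clog 2 (d ^ s ^ 4) * d * s ^ 4 ≤ 2 ^ s ^ 5 * s * s ^ 4 := by gcongr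
        gcongr
        · omega
        · exact h.lt_pow.le
    _ = 31 * s ^ 6 * 2 ^ s ^ 5 * 2 ^ s := by ring
    _ ≤ 2 ^ 5 * (2 ^ s) ^ 6 * 2 ^ s ^ 5 * 2 ^ s := by
        gcongr
        norm_num
    _ = 2 ^ (5 + s * 6 + s ^ 5 + s) := by
        rw [pow_add, pow_add, pow_add, pow_mul]
    _ ≤ 2 ^ s ^ 6 := by
        apply Nat.pow_le_pow_right (by norm_num)
        have h5 : 4 ^ 4 * s ≤ s ^ 4 * s := by gcongr
        have h6 : 4 * s ^ 5 ≤ s * s ^ 5 := by gcongr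
        have e5 : s ^ 4 * s = s ^ 5 := by ring
        have e6 : s * s ^ 5 = s ^ 6 := by ring
        omega
    _ ≤ n := h.two_pow_le

theorem N_le : (mainLayout n w s d k).N ≤ n + w ^ 4 * s ^ 4 := by
  simp only [Layout.N, Layout.B, mainLayout, add_mul, one_mul]
  exact Nat.add_le_add_right (Nat.div_mul_le_self _ _) _

theorem le_N (h : Regime n w s c d) : n ≤ (mainLayout n w s d k).N := by
  have h4 := h.four_le
  have h8 := h.eight_mul_lt
  simp only [Layout.N, Layout.B, mainLayout]
  have h1 : 0 < w ^ 4 * s ^ 4 := Nat.mul_pos (pow_pos (by omega) _) (pow_pos (by omega) _)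
  have := Nat.lt_div_mul_add h1 (a := n)
  rw [add_mul, one_mul]
  exact this.le

theorem four_mul_le (h : Regime n w s c d) : 4 * n ≤ 2 ^ w := by
  have h1 : n < 2 ^ (Nat.log 2 n + 1) := Nat.lt_pow_succ_log_self (by norm_num) n
  have h2 : 2 ^ (Nat.log 2 n + 4) ≤ 2 ^ w := Nat.pow_le_pow_right (by norm_num) h.log_le
  rw [pow_add] at h1 h2
  omega

theorem N_lt (h : Regime n w s c d) : (mainLayout n w s d k).N < 2 ^ w := by
  have h1 := N_le (n := n) (w := w) (s := s) (d := d) (k := k)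
  have h2 := h.block_mul_le
  have h3 := h.four_mul_le
  have h4 := h.four_le
  have h5 := h.pos
  have h6 : w ^ 4 * s ^ 4 ≤ s * (w ^ 4 * s ^ 4) := Nat.le_mul_of_pos_left _ (by omega)
  omega

theorem valid (h : Regime n w s c d) (ht : (mainLayout n w s d k).total ≤ 2 ^ w) : (mainLayout n w s d k).Valid := by
  have h4 := h.four_le
  have h8 := h.eight_mul_lt
  have hd := h.d_le
  have hd2 := h.two_le
  have hN := h.N_lt (k := k)
  have hw : 0 < w := by omega
  have hB : (mainLayout n w s d k).B / (mainLayout n w s d k).u₂ = w ^ 4 * s ^ 2 := by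
    simp only [Layout.B, mainLayout]
    rw [show w ^ 4 * s ^ 4 = w ^ 4 * s ^ 2 * s ^ 2 by ring]
    exact Nat.mul_div_cancel _ (by positivity)
  have hw4 : 1 ≤ w ^ 4 := Nat.one_le_pow _ _ hw
  have hs2 : 1 ≤ s ^ 2 := Nat.one_le_pow _ _ (by omega)
  have hs4 : s * 2 ≤ s ^ 2 := by nlinarith
  exact
    { K_pos := Nat.succ_pos _
      G_pos := pow_pos hw _
      g_pos := pow_pos (by omega) _
      d_pos := by change 0 < d; omega
      u₁_pos := pow_pos hw _
      u₂_pos := pow_pos (by omega) _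
      b_pos := h.clog_pos
      f_pos := by change 0 < 8 * s; omega
      b_lt := by
        change Nat.clog 2 (d ^ s ^ 4) < w
        have h1 : Nat.clog 2 (d ^ s ^ 4) ≤ s * s ^ 4 :=
          (clog_le s d).trans (Nat.mul_le_mul_right _ hd)
        calc _ ≤ s * s ^ 4 := h1
          _ = s ^ 5 := by ring
          _ < s ^ 10 := Nat.pow_lt_pow_right (by omega) (by norm_num)
          _ ≤ w := h.pow_le
      f_lt := h8
      code_le := Nat.le_pow_clog (by norm_num) _
      B_lt := by
        -- Source of the field width `8 * s`: ranks within a block are at most `w ^ 8`, and `w < 2 ^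
        -- s`.
        change w ^ 4 * s ^ 4 < 2 ^ (8 * s)
        calc w ^ 4 * s ^ 4 ≤ w ^ 4 * w ^ 4 := by gcongr; omega
          _ = w ^ 8 := by ring
          _ < (2 ^ s) ^ 8 := Nat.pow_lt_pow_left h.lt_pow (by norm_num)
          _ = 2 ^ (8 * s) := by ring
      N_lt := hN
      total_le := ht
      rank_le := by
        refine le_trans ?_ hN.le
        change d * _ * (w ^ 4 + 1) ≤ _ * (w ^ 4 * s ^ 4)
        generalize (mainLayout n w s d k).K = K
        calc d * K * (w ^ 4 + 1) ≤ s * K * (w ^ 4 + w ^ 4) := by gcongr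
          _ = K * w ^ 4 * (s * 2 * 1) := by ring
          _ ≤ K * w ^ 4 * (s ^ 2 * s ^ 2) := by gcongr
          _ = K * (w ^ 4 * s ^ 4) := by ring
      sample_le := by
        rw [hB]
        refine le_trans ?_ hN.le
        change d * _ * (w ^ 4 * s ^ 2 + 1) ≤ _ * (w ^ 4 * s ^ 4)
        generalize (mainLayout n w s d k).K = K
        calc d * K * (w ^ 4 * s ^ 2 + 1) ≤ s * K * (w ^ 4 * s ^ 2 + w ^ 4 * s ^ 2) := by
              gcongr
              exact Nat.mul_pos hw4 hs2
          _ = K * w ^ 4 * s ^ 2 * (s * 2) := by ring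
          _ ≤ K * w ^ 4 * s ^ 2 * s ^ 2 := by gcongr
          _ = K * (w ^ 4 * s ^ 4) := by ring
      fix_le := by
        refine le_trans ?_ hN.le
        change d * _ * w ^ 4 * (s ^ 2 + 1) ≤ _ * (w ^ 4 * s ^ 4)
        generalize (mainLayout n w s d k).K = K
        calc d * K * w ^ 4 * (s ^ 2 + 1) ≤ s * K * w ^ 4 * (s ^ 2 + s ^ 2) := by gcongr
          _ = K * w ^ 4 * s ^ 2 * (s * 2) := by ring
          _ ≤ K * w ^ 4 * s ^ 2 * s ^ 2 := by gcongr
          _ = K * (w ^ 4 * s ^ 4) := by ring }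

theorem clog_le_logb (h : Regime n w s c d) :
    (Nat.clog 2 (d ^ s ^ 4) : ℝ) ≤ s ^ 4 * Real.logb 2 d + 1 := by
  have hpos := h.clog_pos
  have h2 := h.two_le
  have h1 := Nat.pow_pred_clog_lt_self (b := 2) (by norm_num) (x := d ^ s ^ 4) (by
    by_contra hc
    rw [Nat.clog_of_right_le_one (not_lt.1 hc)] at hpos
    exact lt_irrefl _ hpos)
  have h3 : ((2 : ℝ) ^ (Nat.clog 2 (d ^ s ^ 4)).pred) ≤ (d : ℝ) ^ s ^ 4 := by
    exact_mod_cast h1.le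
  have h5 := Real.logb_le_logb_of_le (b := 2) (by norm_num) (by positivity) h3
  rw [Real.logb_pow, Real.logb_pow, Real.logb_self_eq_one (by norm_num), mul_one] at h5
  have h6 : (Nat.clog 2 (d ^ s ^ 4) : ℝ) = ((Nat.clog 2 (d ^ s ^ 4)).pred : ℝ) + 1 := by
    have := Nat.succ_pred_eq_of_pos hpos
    exact_mod_cast this.symm
  rw [h6]
  push_cast at h5
  linarith

/-- The size of the data structure. -/
theorem total_mul_le (h : Regime n w s c d) : ((mainLayout n w s d k).total * w : ℝ) ≤
    n / s + 2 * k * ((n + n / s) * (Real.logb 2 d + 103 * d / s)) := by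
  have h4 := h.four_le
  have hs : (0 : ℝ) < s := by exact_mod_cast (by omega : 0 < s)
  have ht := h.tables_mul_le
  have hst := stride_mul_le (n := n) (w := w) (s := s) (d := d) (k := k) (by omega)
    h.eight_mul_lt.le (by have := h.two_le; omega) h.clog_pos h.clog_sq_le
  have hNle := N_le (n := n) (w := w) (s := s) (d := d) (k := k)
  have hBle := h.block_mul_le
  set T := 28 + 2 ^ Nat.clog 2 (d ^ s ^ 4) * s ^ 4
    + 2 ^ Nat.clog 2 (d ^ s ^ 4) * s ^ 4 + 2 ^ Nat.clog 2 (d ^ s ^ 4) * d * s ^ 4 with hT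
  have htot : (mainLayout n w s d k).total = T + 2 * k * (mainLayout n w s d k).stride := by
    simp only [Layout.total, Layout.sizes, List.sum_cons, List.sum_nil, hT]
    change 28 + (_ + (_ + (_ + (2 * k * _ + 0)))) = _
    simp only [mainLayout]
    ring
  have hN : (mainLayout n w s d k).N = (n / (w ^ 4 * s ^ 4) + 1) * (w ^ 4 * s ^ 4) := rfl
  rw [hN] at hNle
  rw [htot]
  generalize (mainLayout n w s d k).stride = st at *
  generalize n / (w ^ 4 * s ^ 4) + 1 = K at *
  have ht' : (T * w : ℝ) ≤ n / s := by
    rw [le_div_iff₀ hs]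
    calc (T * w * s : ℝ) = ((s * (T * w) : ℕ) : ℝ) := by push_cast; ring
      _ ≤ n := by exact_mod_cast ht
  have hN' : (K * (w ^ 4 * s ^ 4) : ℝ) ≤ n + n / s := by
    have h1 : (w ^ 4 * s ^ 4 : ℝ) ≤ n / s := by
      rw [le_div_iff₀ hs]
      calc (w ^ 4 * s ^ 4 * s : ℝ) = ((s * (w ^ 4 * s ^ 4) : ℕ) : ℝ) := by push_cast; ring
        _ ≤ n := by exact_mod_cast hBle
    have h2 : (K * (w ^ 4 * s ^ 4) : ℝ) ≤ n + w ^ 4 * s ^ 4 := by exact_mod_cast hNle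
    linarith
  have hlog : 0 ≤ Real.logb 2 d :=
    Real.logb_nonneg (by norm_num) (by exact_mod_cast (by have := h.two_le; omega : 1 ≤ d))
  have hd1 : (1 : ℝ) ≤ d := by exact_mod_cast (by have := h.two_le; omega : 1 ≤ d)
  have hs1 : (1 : ℝ) ≤ (s : ℝ) ^ 3 := one_le_pow₀ (by exact_mod_cast (by omega : 1 ≤ s))
  have hst' : (st * w : ℝ) ≤ (n + n / s) * (Real.logb 2 d + 103 * d / s) := by
    calc (st * w : ℝ) ≤ K * w ^ 4 * (Nat.clog 2 (d ^ s ^ 4) + 102 * d * s ^ 3) := by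
          exact_mod_cast hst
      -- Rounding the code length up costs one bit per chunk, which turns 102 into 103.
      _ ≤ K * w ^ 4 * (s ^ 4 * Real.logb 2 d + 103 * d * s ^ 3) := by
          refine mul_le_mul_of_nonneg_left ?_ (by positivity)
          have h1 := h.clog_le_logb
          have h2 := one_le_mul_of_one_le_of_one_le hd1 hs1
          linarith
      _ = K * (w ^ 4 * s ^ 4) * (Real.logb 2 d + 103 * d / s) := by
          field_simp
      _ ≤ _ := by gcongr
  push_cast
  calc ((T + 2 * k * st) * w : ℝ) = T * w + 2 * k * (st * w) := by ring
    _ ≤ _ := by gcongr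

end Regime

/-! ### Assembly of the encodings -/

open StableSort

/-- With the data `E`, the query programs answer all queries about `π` in the time allowed for
`σ` classes. -/
def Encodes (w : ℕ) (E : List Bool) {n : ℕ} (π : Equiv.Perm (Fin n)) (σ : ℕ) : Prop :=
  (∀ i : Fin n, ∃ t : ℕ, Answers applyProg w E i (π i) t ∧
    (t : ℝ) ≤ 2 * queryCost * (1 + Real.logb 2 σ)) ∧
  ∀ i : Fin n, ∃ t : ℕ, Answers applyInvProg w E i (π.symm i) t ∧
    (t : ℝ) ≤ 2 * queryCost * (1 + Real.logb 2 σ)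

theorem encodes_nil {n w : ℕ} (hn : n ≤ 2 ^ w) : Encodes w [] (1 : Equiv.Perm (Fin n)) 1 := by
  have hcost : (((hd 0).cost + 1 + 1 : ℕ) : ℝ)
      ≤ 2 * queryCost * (1 + Real.logb 2 (1 : ℕ)) := by
    have h1 : (hd 0).cost + 1 + 1 ≤ 2 * queryCost := by unfold queryCost; omega
    rw [Nat.cast_one, Real.logb_one, add_zero, mul_one]
    exact_mod_cast h1
  exact ⟨fun i => ⟨_, answers_nil w i (i.2.trans_le hn) _ _ _, hcost⟩,
    fun i => ⟨_, answers_nil w i (i.2.trans_le hn) _ _ _, hcost⟩⟩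

theorem encodes_table {n w σ : ℕ} (hn : 2 + 2 * n ≤ 2 ^ w) (hσ : 0 < σ)
    (π : Equiv.Perm (Fin n)) : ∃ E : List Bool, E.length = (2 + 2 * n) * w ∧ Encodes w E π σ := by
  let f : ℕ → ℕ := fun x => if h : x < n then π ⟨x, h⟩ else 0
  let g : ℕ → ℕ := fun x => if h : x < n then π.symm ⟨x, h⟩ else 0
  have hf : ∀ i : Fin n, f i = π i := fun i => by simp [f]
  have hg : ∀ i : Fin n, g i = π.symm i := fun i => by simp [g]
  have hlog : 0 ≤ Real.logb 2 σ := Real.logb_nonneg (by norm_num) (by exact_mod_cast hσ)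
  have hcost : ∀ t ≤ queryCost, (t : ℝ) ≤ 2 * queryCost * (1 + Real.logb 2 σ) := fun t ht => by
    have h1 : (t : ℝ) ≤ queryCost := by exact_mod_cast ht
    have h2 : (0 : ℝ) ≤ queryCost := Nat.cast_nonneg _
    nlinarith [mul_nonneg h2 hlog]
  have h := fun i : Fin n => answers_table hn (f := f) (g := g) i.2 (by rw [hf]; exact (π i).2)
    (by rw [hg]; exact (π.symm i).2)
  refine ⟨bits w (2 + 2 * n) (tableImage n f g), length_bits _ _ _, fun i => ?_, fun i => ?_⟩
  · obtain ⟨t, ht, ha⟩ := (h i).1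
    exact ⟨t, hf i ▸ ha, hcost t ht⟩
  · obtain ⟨t, ht, ha⟩ := (h i).2
    exact ⟨t, hg i ▸ ha, hcost t ht⟩

/-- The first `k` levels hold the digits for the positions, the last `k` those for the values. The
sweep returns some `z` with the correct place, and injectivity of `pos` identifies it. -/
theorem encodes_layout {P : Layout} (hP : P.Valid) {n σ : ℕ} {π : Equiv.Perm (Fin n)}
    (hn : 0 < n) (hN : n ≤ P.N) (hπ : IsCoveredBySUS π σ) (hσ : σ ≤ P.d ^ P.k)
    (hk : (P.k : ℝ) ≤ 1 + 2 * Real.logb 2 σ) :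
    ∃ E : List Bool, E.length = P.total * P.w ∧ Encodes P.w E π σ := by
  obtain ⟨S, U, hS, hU, h⟩ := hπ.exists_pos_eq hn hN
  obtain ⟨L, hL, hLc⟩ := exists_sortChain (N := P.N) P.k S fun y _ => (hS y).trans_le hσ
  obtain ⟨M, hM, hMc⟩ := exists_sortChain (N := P.N) P.k U fun y _ => (hU y).trans_le hσ
  let V : ℕ → ℕ → ℕ := fun l => if l < P.k then L l else M (l - P.k)
  have hV : ∀ l < 2 * P.k, ∀ y < P.N, V l y < P.d := fun l hl y hy => by
    by_cases hlk : l < P.k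
    · simpa [V, hlk] using hL l hlk y hy
    · simpa [V, hlk] using hM (l - P.k) (by omega) y hy
  have hV1 : ∀ x < P.N, sortChain V P.N P.k x = pos S P.N x := fun x hx => by
    rw [sortChain_congr (U := L) (fun l hl => by simp [V, hl]), hLc x hx]
  have hV2 : ∀ x < P.N, sortChain (fun l => V (P.k + l)) P.N P.k x = pos U P.N x :=
    fun x hx => by
      rw [sortChain_congr (U := M) (fun l hl => by simp [V]), hMc x hx]
  have hcost : ∀ t ≤ queryCost * (P.k + 1),
      (t : ℝ) ≤ 2 * queryCost * (1 + Real.logb 2 σ) := fun t ht => by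
    have h1 : (t : ℝ) ≤ queryCost * (P.k + 1) := by exact_mod_cast ht
    have h2 : (0 : ℝ) ≤ queryCost := Nat.cast_nonneg _
    have h3 := mul_le_mul_of_nonneg_left hk h2
    linarith
  refine ⟨bits P.w P.total (P.image V), length_bits _ _ _, fun i => ?_, fun i => ?_⟩
  · obtain ⟨z, hz, hc, t, ht, ha⟩ := (answers_layout hP hV (i.2.trans_le hN)).1
    rw [hV1 _ (i.2.trans_le hN), hV2 _ hz, ← h i] at hc
    have := pos_inj hz ((π i).2.trans_le hN) hc
    exact ⟨t, this ▸ ha, hcost t ht⟩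
  · obtain ⟨z, hz, hc, t, ht, ha⟩ := (answers_layout hP hV (i.2.trans_le hN)).2
    have h1 := h (π.symm i)
    rw [Equiv.apply_symm_apply] at h1
    rw [hV1 _ hz, hV2 _ (i.2.trans_le hN), h1] at hc
    have := pos_inj hz ((π.symm i).2.trans_le hN) hc
    exact ⟨t, this ▸ ha, hcost t ht⟩

/-- A radix `d` and a number of digits `k` that represent `σ` values with little waste. -/
theorem exists_radix {A : ℕ} (hA : 0 < A) {σ : ℕ} (hσ : 2 ≤ σ) :
    ∃ d k : ℕ, 2 ≤ d ∧ d ≤ 2 ^ A ∧ σ ≤ d ^ k ∧ (k : ℝ) ≤ 2 * Real.logb 2 σ ∧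
      k * Real.logb 2 d ≤ Real.logb 2 σ * (1 + 1 / A) := by
  have hlog : 1 ≤ Real.logb 2 σ := by
    rw [Real.le_logb_iff_rpow_le (by norm_num) (by positivity), Real.rpow_one]
    exact_mod_cast hσ
  have hA' : (0 : ℝ) < A := by exact_mod_cast hA
  by_cases h : σ ≤ 2 ^ A
  · refine ⟨σ, 1, hσ, h, by simp, by push_cast; linarith, ?_⟩
    have : 0 ≤ Real.logb 2 σ * (1 / A) := by positivity
    push_cast
    linarith
  -- For `lg σ` above `A`, binary digits waste at most one unit of `lg σ`, a fraction at most `1 /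
  -- A`.
  · have h1 : (Nat.clog 2 σ : ℝ) ≤ Real.logb 2 σ + 1 := by
      have hpos : 0 < Nat.clog 2 σ := Nat.clog_pos (by norm_num) hσ
      have h3 : ((2 : ℝ) ^ (Nat.clog 2 σ).pred) ≤ (σ : ℝ) := by
        exact_mod_cast (Nat.pow_pred_clog_lt_self (b := 2) (by norm_num) (by omega)).le
      have h5 := Real.logb_le_logb_of_le (b := 2) (by norm_num) (by positivity) h3
      rw [Real.logb_pow, Real.logb_self_eq_one (by norm_num), mul_one] at h5
      have h6 : (Nat.clog 2 σ : ℝ) = ((Nat.clog 2 σ).pred : ℝ) + 1 := by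
        have := Nat.succ_pred_eq_of_pos hpos
        exact_mod_cast this.symm
      rw [h6]
      linarith
    have h2 : (A : ℝ) ≤ Real.logb 2 σ := by
      rw [Real.le_logb_iff_rpow_le (by norm_num) (by positivity), Real.rpow_natCast]
      exact_mod_cast (not_le.1 h).le
    refine ⟨2, Nat.clog 2 σ, le_rfl, Nat.le_self_pow hA.ne' 2, Nat.le_pow_clog (by norm_num) _,
      by linarith, ?_⟩
    have h3 : 1 ≤ Real.logb 2 σ * (1 / A) := by
      rw [mul_one_div, le_div_iff₀ hA']
      linarith
    rw [Nat.cast_ofNat, Real.logb_self_eq_one (by norm_num)]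
    linarith

/-- Half of `δ` pays for the radix, the other half for all terms with `1 / s`: the tables and the
padding give the 3, and the directories give `412 = 2 * 2 * 103` through `k * d ≤ 2 * x * D`. -/
theorem size_bound {n s k x l d D δ : ℝ} (hn : 0 ≤ n) (hs : 1 ≤ s) (hx : 1 ≤ x)
    (hkx : k ≤ 2 * x) (hd : 0 ≤ d) (hdD : d ≤ D) (hl : k * l ≤ x * (1 + δ / 2))
    (hδ : δ ≤ 1) (hsD : (3 + 412 * D) * 2 ≤ δ * s) :
    n / s + 2 * k * ((n + n / s) * (l + 103 * d / s)) ≤ 2 * n * x * (1 + δ) := by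
  obtain ⟨r, hr⟩ : ∃ r, r = 1 / s := ⟨_, rfl⟩
  have hs0 : 0 < s := by linarith
  have hr0 : 0 ≤ r := hr ▸ by positivity
  have hr1 : r ≤ 1 := by rw [hr, div_le_one hs0]; exact hs
  have hrD : r * (3 + 412 * D) ≤ δ / 2 := by
    rw [hr, one_div_mul_eq_div, div_le_iff₀ hs0]
    linarith
  have e : n / s + 2 * k * ((n + n / s) * (l + 103 * d / s))
      = n * r + 2 * n * (1 + r) * (k * l + 103 * (k * d) * r) := by
    rw [hr]
    field_simp
  have hkd : k * d ≤ 2 * x * D := mul_le_mul hkx hdD hd (by linarith)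
  have hD : 0 ≤ D := hd.trans hdD
  have h1 : k * l + 103 * (k * d) * r ≤ x * (1 + δ / 2 + 206 * D * r) := by
    have := mul_le_mul_of_nonneg_right hkd hr0
    linarith
  have h2 : (1 + r) * (1 + δ / 2 + 206 * D * r) ≤ 1 + δ / 2 + r * (2 + 412 * D) := by
    have h3 : r * (206 * D * r) ≤ r * (206 * D * 1) := by gcongr
    have h4 : r * δ ≤ r * 1 := by gcongr
    nlinarith
  rw [e]
  calc n * r + 2 * n * (1 + r) * (k * l + 103 * (k * d) * r)
      ≤ n * r + 2 * n * (1 + r) * (x * (1 + δ / 2 + 206 * D * r)) := by gcongr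
    _ = n * r + 2 * n * x * ((1 + r) * (1 + δ / 2 + 206 * D * r)) := by ring
    _ ≤ 2 * n * x * r + 2 * n * x * (1 + δ / 2 + r * (2 + 412 * D)) := by
        gcongr
        nlinarith
    _ = 2 * n * x * (1 + δ / 2 + r * (3 + 412 * D)) := by ring
    _ ≤ 2 * n * x * (1 + δ / 2 + δ / 2) := by gcongr
    _ = 2 * n * x * (1 + δ) := by ring

/-- Every permutation of `n` elements covered by `σ ≥ 2` shuffled upsequences has an encoding of
at most `2 * n * log₂ σ * (1 + δ)` bits. -/
def HasEncodings (c n : ℕ) (δ : ℝ) : Prop :=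
  ∀ (w σ : ℕ) (π : Equiv.Perm (Fin n)), 0 < n → Nat.log 2 n + 4 ≤ w →
    w ≤ c * (Nat.log 2 n + 1) → 2 ≤ σ → IsCoveredBySUS π σ →
    ∃ E : List Bool, (E.length : ℝ) ≤ 2 * n * Real.logb 2 σ * (1 + δ) ∧ Encodes w E π σ

theorem one_le_logb {σ : ℕ} (hσ : 2 ≤ σ) : 1 ≤ Real.logb 2 σ := by
  rw [Real.le_logb_iff_rpow_le (by norm_num) (by positivity), Real.rpow_one]
  exact_mod_cast hσ

theorem HasEncodings.mono {c n : ℕ} {δ δ' : ℝ} (h : HasEncodings c n δ) (hδ : δ ≤ δ') :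
    HasEncodings c n δ' := fun w σ π hn hw hwc hσ hπ => by
  obtain ⟨E, hE, hE'⟩ := h w σ π hn hw hwc hσ hπ
  refine ⟨E, hE.trans ?_, hE'⟩
  have := one_le_logb hσ
  gcongr

theorem two_add_le {n w : ℕ} (hw : Nat.log 2 n + 4 ≤ w) : 2 + 2 * n ≤ 2 ^ w := by
  have h1 : n < 2 ^ (Nat.log 2 n + 1) := Nat.lt_pow_succ_log_self (by norm_num) n
  have h2 : 2 ^ (Nat.log 2 n + 4) ≤ 2 ^ w := Nat.pow_le_pow_right (by norm_num) hw
  rw [pow_add] at h1 h2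
  omega

/-- Explicit tables give some finite error for each `n`, since `w` is bounded in terms of `n` and
`c`. -/
theorem exists_hasEncodings (c n : ℕ) : ∃ δ, HasEncodings c n δ := by
  refine ⟨((2 + 2 * n) * (c * (Nat.log 2 n + 1)) : ℕ), fun w σ π hn hw hwc hσ hπ => ?_⟩
  obtain ⟨E, hE, hE'⟩ := encodes_table (two_add_le hw) (by omega : 0 < σ) π
  refine ⟨E, ?_, hE'⟩
  have h1 : E.length ≤ (2 + 2 * n) * (c * (Nat.log 2 n + 1)) :=
    hE.trans_le (Nat.mul_le_mul_left _ hwc)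
  generalize (2 + 2 * n) * (c * (Nat.log 2 n + 1)) = m at *
  have h2 : (E.length : ℝ) ≤ m := by exact_mod_cast h1
  have h3 := one_le_logb hσ
  have h4 : (1 : ℝ) ≤ n := by exact_mod_cast hn
  have h5 : 1 ≤ (n : ℝ) * Real.logb 2 σ := one_le_mul_of_one_le_of_one_le h4 h3
  have h6 : (0 : ℝ) ≤ m := Nat.cast_nonneg _
  calc (E.length : ℝ) ≤ m := h2
    _ ≤ 2 * 1 * (1 + m) := by linarith
    _ ≤ 2 * (n * Real.logb 2 σ) * (1 + m) := by gcongr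
    _ = 2 * n * Real.logb 2 σ * (1 + m) := by ring

theorem eventually_pow_le : ∃ s₁ : ℕ, ∀ s ≥ s₁, 2 * s ^ 10 ≤ 2 ^ s := by
  have h := tendsto_pow_const_div_const_pow_of_one_lt 10 (r := (2 : ℝ)) (by norm_num)
  obtain ⟨s₁, hs₁⟩ := eventually_atTop.1 (h.eventually (gt_mem_nhds (by norm_num : (0 : ℝ) < 1 / 2)))
  refine ⟨s₁, fun s hs => ?_⟩
  have h1 := hs₁ s hs
  rw [div_lt_iff₀ (by positivity)] at h1
  have h2 : (2 * s ^ 10 : ℝ) ≤ 2 ^ s := by linarith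
  exact_mod_cast h2

/-- The order of choices matters: `δ` fixes `A` and hence the alphabet bound `2 ^ A`; only then is
`n` taken so large that `s` exceeds every constant. -/
theorem eventually_hasEncodings (c : ℕ) {δ : ℝ} (hδ0 : 0 < δ) (hδ : δ ≤ 1) :
    ∀ᶠ n in atTop, HasEncodings c n δ := by
  obtain ⟨A, hA⟩ := exists_nat_gt (2 / δ)
  have hA0 : 0 < A := by
    have : (0 : ℝ) < A := lt_trans (by positivity) hA
    exact_mod_cast this
  have hA1 : 1 / (A : ℝ) ≤ δ / 2 := by
    rw [div_lt_iff₀ hδ0] at hA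
    rw [div_le_iff₀ (by exact_mod_cast hA0)]
    linarith
  obtain ⟨s₁, hs₁⟩ := eventually_pow_le
  obtain ⟨s₂, hs₂⟩ := exists_nat_gt ((3 + 412 * ((2 ^ A : ℕ) : ℝ)) * 2 / δ)
  -- The summands secure `4 ≤ s`, `c ≤ s`, `d ≤ s`, `s ^ 10 ≤ w` and the hypothesis of `size_bound`.
  set s₀ := 4 + c + 2 ^ A + s₁ + s₂ with hs₀
  filter_upwards [eventually_ge_atTop (2 ^ 2 ^ s₀)] with n hn w σ π hn0 hw hwc hσ hπ
  have hlogn : 2 ^ s₀ ≤ Nat.log 2 n := Nat.le_log_of_pow_le (by norm_num) hn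
  have hlogw : s₀ ≤ Nat.log 2 w := Nat.le_log_of_pow_le (by norm_num) (by omega)
  obtain ⟨s, hs⟩ : ∃ s, s = Nat.log 2 w + 1 := ⟨_, rfl⟩
  have hw0 : w ≠ 0 := by omega
  obtain ⟨d, k, hd2, hdA, hdk, hk, hkd⟩ := exists_radix hA0 hσ
  have hreg : Regime n w s c d :=
    { four_le := by omega
      d_le := by omega
      two_le := hd2
      c_le := by omega
      pow_le := by
        have h1 := hs₁ s (by omega)
        have h2 := Nat.pow_log_le_self 2 hw0
        rw [hs, pow_succ 2] at h1
        rw [hs]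
        omega
      lt_pow := hs ▸ Nat.lt_pow_succ_log_self (by norm_num) w
      log_le := hw
      le_log := hwc
      pos := hn0 }
  have hlog := one_le_logb hσ
  have hsize : ((mainLayout n w s d k).total * w : ℝ) ≤ 2 * n * Real.logb 2 σ * (1 + δ) := by
    refine hreg.total_mul_le.trans (size_bound (D := ((2 ^ A : ℕ) : ℝ)) (Nat.cast_nonneg _)
      (by exact_mod_cast (by omega : 1 ≤ s)) hlog hk (Nat.cast_nonneg _)
      (by exact_mod_cast hdA) (hkd.trans (by gcongr)) hδ ?_)
    rw [div_lt_iff₀ hδ0] at hs₂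
    have h1 : (s₂ : ℝ) ≤ s := by exact_mod_cast (by omega : s₂ ≤ s)
    nlinarith
  -- Addressability follows from the size bound itself: `lg σ ≤ w` and `δ ≤ 1` leave at most `4 * n`
  -- cells.
  have htot : (mainLayout n w s d k).total ≤ 2 ^ w := by
    refine le_trans ?_ hreg.four_mul_le
    have hwpos : (0 : ℝ) < w := by exact_mod_cast Nat.pos_of_ne_zero hw0
    have h1 : Real.logb 2 σ ≤ w := by
      rw [Real.logb_le_iff_le_rpow (by norm_num) (by positivity), Real.rpow_natCast]
      have h2 := hreg.four_mul_le
      have h3 := hπ.le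
      exact_mod_cast (by omega : σ ≤ 2 ^ w)
    have h2 : ((mainLayout n w s d k).total * w : ℝ) ≤ 4 * n * w := by
      calc _ ≤ 2 * n * Real.logb 2 σ * (1 + δ) := hsize
        _ ≤ 2 * n * w * (1 + 1) := by gcongr
        _ = 4 * n * w := by ring
    have h3 := le_of_mul_le_mul_right h2 hwpos
    exact_mod_cast h3
  obtain ⟨E, hE, hE'⟩ := encodes_layout (P := mainLayout n w s d k) (hreg.valid htot) hn0
    hreg.le_N hπ hdk (le_trans hk (by linarith))
  refine ⟨E, ?_, hE'⟩
  rw [hE]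
  push_cast
  exact hsize

/-- `ε n` is the infimum of the nonnegative admissible errors, plus `1 / (n + 1)` because the
infimum need not be attained. -/
theorem exists_tendsto_zero {Q : ℕ → ℝ → Prop} (hmono : ∀ n a b, a ≤ b → Q n a → Q n b)
    (hex : ∀ n, ∃ a, Q n a) (hev : ∀ δ > 0, ∀ᶠ n in atTop, Q n δ) :
    ∃ ε : ℕ → ℝ, Tendsto ε atTop (𝓝 0) ∧ ∀ n, Q n (ε n) := by
  have hne : ∀ n, {a | 0 ≤ a ∧ Q n a}.Nonempty := fun n => by
    obtain ⟨a, ha⟩ := hex n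
    exact ⟨max a 0, le_max_right _ _, hmono n a _ (le_max_left _ _) ha⟩
  have hbdd : ∀ n, BddBelow {a | 0 ≤ a ∧ Q n a} := fun n => ⟨0, fun a ha => ha.1⟩
  refine ⟨fun n => sInf {a | 0 ≤ a ∧ Q n a} + 1 / ((n : ℝ) + 1), ?_, fun n => ?_⟩
  · suffices h : Tendsto (fun n => sInf {a | 0 ≤ a ∧ Q n a}) atTop (𝓝 0) by
      simpa using h.add tendsto_one_div_add_atTop_nhds_zero_nat
    rw [Metric.tendsto_nhds]
    intro δ hδ
    filter_upwards [hev (δ / 2) (by positivity)] with n hn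
    have h1 : sInf {a | 0 ≤ a ∧ Q n a} ≤ δ / 2 := csInf_le (hbdd n) ⟨by positivity, hn⟩
    have h2 : 0 ≤ sInf {a | 0 ≤ a ∧ Q n a} := le_csInf (hne n) fun a ha => ha.1
    rw [Real.dist_eq, sub_zero, abs_of_nonneg h2]
    linarith
  · obtain ⟨a, ha, hlt⟩ := exists_lt_of_csInf_lt (hne n)
      (show sInf {a | 0 ≤ a ∧ Q n a} < sInf {a | 0 ≤ a ∧ Q n a} + 1 / ((n : ℝ) + 1) by
        have : (0 : ℝ) < 1 / ((n : ℝ) + 1) := by positivity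
        linarith)
    exact hmono n a _ hlt.le ha.2

end WordRAM

theorem mainTheorem12 :
    ∃ w₀ : ℕ, ∀ c : ℕ, ∃ (apply applyInv : WordRAM.Prog) (C T : ℝ) (ε : ℕ → ℝ),
      Tendsto ε atTop (𝓝 0) ∧
      ∀ (n w σ : ℕ) (π : Equiv.Perm (Fin n)), 0 < n →
        Nat.log 2 n + w₀ ≤ w → w ≤ c * (Nat.log 2 n + 1) →
        IsCoveredBySUS π σ →
        ∃ E : List Bool,
          (E.length : ℝ) ≤ 2 * n * Real.logb 2 σ * (1 + ε n)
            + σ * Real.logb 2 ((n : ℝ) / σ) + C * σ ∧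
          (∀ i : Fin n, ∃ t : ℕ, WordRAM.Answers apply w E i (π i) t ∧
            (t : ℝ) ≤ T * (1 + Real.logb 2 σ)) ∧
          (∀ i : Fin n, ∃ t : ℕ, WordRAM.Answers applyInv w E i (π.symm i) t ∧
            (t : ℝ) ≤ T * (1 + Real.logb 2 σ)) := by
  refine ⟨4, fun c => ?_⟩
  obtain ⟨ε, hε, hQ⟩ := WordRAM.exists_tendsto_zero (Q := WordRAM.HasEncodings c)
    (fun n a b hab h => h.mono hab) (WordRAM.exists_hasEncodings c) (fun δ hδ => by
      filter_upwards [WordRAM.eventually_hasEncodings c (δ := min δ 1) (lt_min hδ one_pos)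
        (min_le_right _ _)] with n hn
      exact hn.mono (min_le_left _ _))
  -- The encoding meets the bound without its last two terms, so `C = 0`; of `σ lg (n / σ)` only
  -- nonnegativity is used.
  refine ⟨WordRAM.applyProg, WordRAM.applyInvProg, 0, 2 * WordRAM.queryCost, ε, hε,
    fun n w σ π hn hw hwc hπ => ?_⟩
  have hσ := hπ.pos hn
  have hσn := hπ.le
  have hlog : 0 ≤ σ * Real.logb 2 ((n : ℝ) / σ) := by
    refine mul_nonneg (Nat.cast_nonneg _) (Real.logb_nonneg (by norm_num) ?_)
    rw [le_div_iff₀ (by exact_mod_cast hσ), one_mul]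
    exact_mod_cast hσn
  rcases Nat.lt_or_ge σ 2 with h | h
  -- A single class forces the identity. The leading term vanishes here, so the empty string is
  -- used.
  · obtain rfl : σ = 1 := by omega
    obtain rfl := hπ.eq_one
    have := WordRAM.two_add_le hw
    refine ⟨[], ?_, WordRAM.encodes_nil (by omega)⟩
    rw [Nat.cast_one, Real.logb_one] at *
    simpa using hlog
  · obtain ⟨E, hE, hE'⟩ := hQ n w σ π hn hw hwc h hπ
    exact ⟨E, by linarith, hE'⟩
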